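/- **Model.** There are $n=3$ items and $k=2$ slots. Each item $i$ can be displayed as an ad or in organic form, with click-through rates $0\le\alpha_i^A<\alpha_i^O\le 1$ and user-experience effects $0\le\gamma_i^A\le\gamma_i^O$. The bids $b_i$ are independent; $b_i\sim F_i$ has support $[0,B_i]$ and a density $f_i$ that is positive on $[0,B_i)$, and $F_i$ is regular: the virtual value $\phi_i(t)=t-\frac{1-F_i(t)}{f_i(t)}$ is non-decreasing on $[0,B_i]$ (with $\phi_i(B_i)=B_i$ if $f_i(B_i)=0$). Write $a_i=\phi_i(b_i)\alpha_i^A+\gamma_i^A$, $o_i=\gamma_i^O$, let $G_i$ be the distribution of $a_i$, and assume that $a_i\ge 0$ for every $b_i\in[0,B_i]$. A merging mechanism $\mathcal M=(x,y,p)$ consists of measurable functions of $\boldsymbol b$ with $x_i,y_i\in\{0,1\}$ (ad form, respectively organic form, of $i$ displayed) and $p_i=0$ where $x_i=0$. Let $X_i=x_i\alpha_i^A+y_i\alpha_i^O$ and $P_i=p_ix_i\alpha_i^A$. The mechanism is IC if $b_iX_i(\boldsymbol b)-P_i(\boldsymbol b)\ge b_iX_i(b_i',\boldsymbol b_{-i})-P_i(b_i',\boldsymbol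 b_{-i})$, IR if $p_i(\boldsymbol b)\le b_i$, and feasible if $\sum_i(x_i+y_i)\le k$ and $x_i+y_i\le1$, for all bid profiles $\boldsymbol b$, all $i$ and all $b_i'\in[0,B_i]$. Its objective is $$\mathrm{OBJ}(\mathcal M)=\mathbb E\Big[\sum_i p_ix_i\alpha_i^A\Big]+\mathbb E\Big[\sum_i\big(x_i\gamma_i^A+y_i\gamma_i^O\big)\Big],$$ where the revenue is required to be integrable. **Generalized change mechanism.** Let $\max^{(m)}$ denote the sum of the $m$ largest of the given numbers. For an ordered set $I=(i_1,\dots,i_k)$ of $k$ distinct items put $$R_t=\sum_{j<t}o_{i_j}+{\max}^{(k-t)}\{a_i: i\notin\{i_1,\dots,i_t\}\},$$ $$w_{i_1}=\mathbb E_{a_{i_1}\sim G_{i_1}}\big[{\max}^{(k)}\{a_1,\dots,a_n\}\big]-R_1,\qquad w_{i_t}=\mathbb E_{a_{i_t}\sim G_{i_t}}\big[\max\{o_{i_{t-1}}+R_{t-1},\,w_{i_{t-1}}+R_{t-1}\}\big]-R_t\quad(t>1),$$ and let $s^*$ be the largest $s\in\{1,\dots,k\}$ with $o_{i_s}\ge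 w_{i_s}$ and $o_{i_t}<w_{i_t}$ for all $t>s$ ($s^*=0$ if there is none). The mechanism $\mathcal M^C_I$ displays $i_1,\dots,i_{s^*}$ in organic form and, in ad form, the $k-s^*$ remaining items with the largest $a_i$ (ties broken by index). The owner of a displayed ad pays, per click, the critical bid $\inf\{b_i'\in[0,B_i]: x_i(b_i',\boldsymbol b_{-i})=1\}$. The generalized change mechanism $\mathcal M^C$ is a mechanism $\mathcal M_I^C$ with the highest objective among all ordered sets $I$ of $k$ items. **Theorem.** For $3$ items and $2$ slots, $\mathcal M^C$ exists and (for every choice of a maximizing $I$) is optimal: it is IC, IR and feasible, and $\mathrm{OBJ}(\mathcal M)\le\mathrm{OBJ}(\mathcal M^C)$ for every IC, IR and feasible merging mechanism $\mathcal M$. -/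

import Mathlib

namespace Merging

open MeasureTheory Set
open scoped Classical

/-- The probability law on `ℝ` with Lebesgue density `f`. -/
noncomputable def densityLaw (f : ℝ → ℝ) : Measure ℝ :=
  volume.withDensity (fun t => ENNReal.ofReal (f t))

/-- Myerson's virtual value `φ(t) = t - (1 - F(t)) / f(t)`, where `F(t)` is the
distribution function of the law with density `f`. -/
noncomputable def virtualValue (f : ℝ → ℝ) (t : ℝ) : ℝ :=
  t - (1 - (densityLaw f).real (Iic t)) / f t

/-- The public data of the problem with `n` items: bid distributions with support `[0, B i]`
and density `f i`, click-through rates and user-experience effects of the two forms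
(`A` = ad form, `O` = organic form). -/
structure Model (n : ℕ) where
  B : Fin n → ℝ
  f : Fin n → ℝ → ℝ
  αA : Fin n → ℝ
  αO : Fin n → ℝ
  γA : Fin n → ℝ
  γO : Fin n → ℝ
  B_nonneg : ∀ i, 0 ≤ B i
  f_measurable : ∀ i, Measurable (f i)
  f_nonneg : ∀ i t, 0 ≤ f i t
  f_pos : ∀ i, ∀ t ∈ Ico 0 (B i), 0 < f i t
  f_zero : ∀ i, ∀ t ∉ Icc 0 (B i), f i t = 0
  f_total : ∀ i, ∫⁻ t, ENNReal.ofReal (f i t) = 1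
  /-- regularity: the virtual value is non-decreasing on the support -/
  regular : ∀ i, MonotoneOn (virtualValue (f i)) (Icc 0 (B i))
  αA_nonneg : ∀ i, 0 ≤ αA i
  αA_lt_αO : ∀ i, αA i < αO i
  αO_le_one : ∀ i, αO i ≤ 1
  γA_nonneg : ∀ i, 0 ≤ γA i
  γA_le_γO : ∀ i, γA i ≤ γO i

/-- A (deterministic) merging mechanism `(x, y, p)`: allocation of the ad forms, allocation of
the organic forms, and payments per click. -/
structure Mechanism (n : ℕ) where
  x : (Fin n → ℝ) → Fin n → ℝ
  y : (Fin n → ℝ) → Fin n → ℝ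
  p : (Fin n → ℝ) → Fin n → ℝ
  x_zero_or_one : ∀ b i, x b i = 0 ∨ x b i = 1
  y_zero_or_one : ∀ b i, y b i = 0 ∨ y b i = 1
  p_eq_zero : ∀ b i, x b i = 0 → p b i = 0

namespace Model

variable {n : ℕ} (E : Model n)

/-- The distribution `F i` of the bid of owner `i`. -/
noncomputable def law (i : Fin n) : Measure ℝ := densityLaw (E.f i)

instance (i : Fin n) : IsProbabilityMeasure (E.law i) :=
  ⟨by simpa [law, densityLaw] using E.f_total i⟩

/-- The joint distribution of the (independent) bids. -/
noncomputable def jointLaw : Measure (Fin n → ℝ) := Measure.pi E.law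

/-- The possible bid profiles. -/
def bids : Set (Fin n → ℝ) := {b | ∀ i, b i ∈ Icc 0 (E.B i)}

/-- The expected click-through rate `X_i(b)`. -/
def ctr (M : Mechanism n) (b : Fin n → ℝ) (i : Fin n) : ℝ :=
  M.x b i * E.αA i + M.y b i * E.αO i

/-- The expected payment `P_i(b)`. -/
def pay (M : Mechanism n) (b : Fin n → ℝ) (i : Fin n) : ℝ :=
  M.p b i * (M.x b i * E.αA i)

/-- Incentive compatibility. -/
def IC (M : Mechanism n) : Prop :=
  ∀ b ∈ E.bids, ∀ i, ∀ b' ∈ Icc 0 (E.B i),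
    b i * E.ctr M (Function.update b i b') i - E.pay M (Function.update b i b') i
      ≤ b i * E.ctr M b i - E.pay M b i

/-- Individual rationality. -/
def IR (M : Mechanism n) : Prop :=
  ∀ b ∈ E.bids, ∀ i, M.p b i ≤ b i

/-- Feasibility with `k` slots. -/
def Feasible (k : ℕ) (M : Mechanism n) : Prop :=
  ∀ b ∈ E.bids, (∑ i, (M.x b i + M.y b i) ≤ k) ∧ ∀ i, M.x b i + M.y b i ≤ 1

/-- The expected revenue. -/
noncomputable def rev (M : Mechanism n) : ℝ :=
  ∫ b, ∑ i, M.p b i * M.x b i * E.αA i ∂E.jointLaw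

/-- The expected user experience. -/
noncomputable def ue (M : Mechanism n) : ℝ :=
  ∫ b, ∑ i, (M.x b i * E.γA i + M.y b i * E.γO i) ∂E.jointLaw

/-- The platform's objective. -/
noncomputable def obj (M : Mechanism n) : ℝ := E.rev M + E.ue M

/-- The objective of the mechanism is a genuine (finite) expectation. -/
def WellDefined (M : Mechanism n) : Prop :=
  (∀ i, Measurable fun b => M.x b i) ∧ (∀ i, Measurable fun b => M.y b i) ∧
  (∀ i, Measurable fun b => M.p b i) ∧
  Integrable (fun b => ∑ i, M.p b i * M.x b i * E.αA i) E.jointLaw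

/-- The constraints of the mechanism design problem with `k` slots. -/
def Admissible (k : ℕ) (M : Mechanism n) : Prop :=
  E.WellDefined M ∧ E.IC M ∧ E.IR M ∧ E.Feasible k M

/-- `M` satisfies the constraints and maximizes the objective among all mechanisms that do. -/
def IsOptimal (k : ℕ) (M : Mechanism n) : Prop :=
  E.Admissible k M ∧ ∀ M', E.Admissible k M' → E.obj M' ≤ E.obj M

/-- The contribution `a_i = φ_i(b_i) α_i^A + γ_i^A` of the ad form of item `i`, as a function
of the bid. The contribution of the organic form is `o_i = γ_i^O`. -/
noncomputable def adValue (i : Fin n) (t : ℝ) : ℝ :=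
  virtualValue (E.f i) t * E.αA i + E.γA i

/-- The distribution `G i` of `a_i`. -/
noncomputable def adLaw (i : Fin n) : Measure ℝ := (E.law i).map (E.adValue i)

end Model

/-- `max^(m) {a_i : i ∈ S}`: the sum of the `m` largest of the numbers `a i`, `i ∈ S`
(for `m ≤ |S|`), that is, the largest sum over an `m`-element subset of `S`. -/
noncomputable def topSum {n : ℕ} (m : ℕ) (S : Finset (Fin n)) (a : Fin n → ℝ) : ℝ :=
  sSup ((fun T : Finset (Fin n) => ∑ i ∈ T, a i) '' {T | T ⊆ S ∧ T.card = m})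

/-- The first `m` items of the ordered set `I`. -/
def firstItems {n k : ℕ} (I : Fin k ↪ Fin n) (m : ℕ) : Finset (Fin n) :=
  (Finset.univ.filter fun t : Fin k => (t : ℕ) < m).map I

namespace Model

variable {n k : ℕ} (E : Model n) (I : Fin k ↪ Fin n)

/-- `R_{t+1} = ∑_{j ≤ t} o_{i_j} + max^(k-t-1) {a_i : i ∉ {i_1, …, i_{t+1}}}`
(the position `t` counts from `0`). -/
noncomputable def R (t : Fin k) (a : Fin n → ℝ) : ℝ :=
  (∑ j : Fin k with j < t, E.γO (I j)) + topSum (k - (t + 1)) (firstItems I (t + 1))ᶜ a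

/-- The recursively defined weight `w_{i_{t+1}}` (the position `t` counts from `0`). The
expectation over `a_{i_{t+1}}` replaces that coordinate of `a` by a fresh draw. -/
noncomputable def w : (t : ℕ) → t < k → (Fin n → ℝ) → ℝ
  | 0, h, a =>
      (∫ s, topSum k Finset.univ (Function.update a (I ⟨0, h⟩) s) ∂E.adLaw (I ⟨0, h⟩))
        - E.R I ⟨0, h⟩ a
  | t + 1, h, a =>
      (∫ s, max
          (E.γO (I ⟨t, by omega⟩)
            + E.R I ⟨t, by omega⟩ (Function.update a (I ⟨t + 1, h⟩) s))
          (w t (by omega) (Function.update a (I ⟨t + 1, h⟩) s)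
            + E.R I ⟨t, by omega⟩ (Function.update a (I ⟨t + 1, h⟩) s))
        ∂E.adLaw (I ⟨t + 1, h⟩))
        - E.R I ⟨t + 1, h⟩ a

/-- The threshold `s*`; it is `0` if no position qualifies. -/
noncomputable def sStar (a : Fin n → ℝ) : ℕ :=
  (Finset.univ.filter fun s : Fin k =>
    (∀ t : Fin k, s < t → E.γO (I t) < E.w I t t.isLt a) ∧
      E.w I s s.isLt a ≤ E.γO (I s)).sup fun s => (s : ℕ) + 1

/-- The items displayed in organic form by the change mechanism of `I`. -/
noncomputable def organicItems (a : Fin n → ℝ) : Finset (Fin n) :=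
  firstItems I (E.sStar I a)

/-- The items displayed in ad form by the change mechanism of `I`: the `k - s*` items with the
largest values `a_i` among those that are not displayed in organic form. Equal values are
ranked by index. -/
noncomputable def adItems (a : Fin n → ℝ) : Finset (Fin n) :=
  Finset.univ.filter fun i =>
    i ∉ E.organicItems I a ∧
      (Finset.univ.filter fun j =>
        j ∉ E.organicItems I a ∧ (a i < a j ∨ (a j = a i ∧ j < i))).card < k - E.sStar I a

/-- The profile `a` of ad contributions at the bid profile `b`. -/
noncomputable def adValues (b : Fin n → ℝ) : Fin n → ℝ := fun i => E.adValue i (b i)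

/-- The generalized change-`I` mechanism. The owner of a displayed ad pays the critical bid,
the infimum of the own bids at which the ad is displayed. -/
noncomputable def changeMechanism : Mechanism n where
  x b i := if i ∈ E.adItems I (E.adValues b) then 1 else 0
  y b i := if i ∈ E.organicItems I (E.adValues b) then 1 else 0
  p b i := if i ∈ E.adItems I (E.adValues b) then
      sInf {t | t ∈ Icc 0 (E.B i) ∧ i ∈ E.adItems I (E.adValues (Function.update b i t))}
    else 0
  x_zero_or_one b i := by by_cases h : i ∈ E.adItems I (E.adValues b) <;> simp [h]
  y_zero_or_one b i := by by_cases h : i ∈ E.organicItems I (E.adValues b) <;> simp [h]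
  p_eq_zero b i := by by_cases h : i ∈ E.adItems I (E.adValues b) <;> simp [h]

/-- `M` is a generalized change mechanism with `k` slots: a change-`I` mechanism with the
highest objective among all ordered sets `I` of `k` items. -/
def IsGeneralizedChange (k : ℕ) (M : Mechanism n) : Prop :=
  ∃ I : Fin k ↪ Fin n, M = E.changeMechanism I ∧
    ∀ J : Fin k ↪ Fin n, E.obj (E.changeMechanism J) ≤ E.obj M

end Model

end Merging

/-!
Every organic display can be priced by an index. For an item `i` let `c_i` be the number with
`𝔼 max(a_i, c_i) = o_i` (`exists_index`; a negative number, standing for `-∞`, if already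
`𝔼 a_i > o_i`), and put `h_i = max(a_i, c_i)`.

*Upper bound* (`obj_le`). Fix an admissible mechanism, an item `i` and the other bids. Click-through
rates are monotone in the own bid, and an organic item pays nothing. If `i` is organic at its highest
bid, it is displayed at every positive bid, and where it is displayed as an ad its owner must be
compensated for the lost clicks; so it contributes at most `o_i ≤ 𝔼 h_i`. Otherwise it is never
organic, the ad is sold at a posted price, and by Myerson's identity
(`setIntegral_virtualValue`) it contributes at most the mean of `a_i ≤ h_i` over the bids at which it
is displayed. In both cases a displayed item counts at most `h_i` (`item_contribution_le`). As two
items are displayed, the objective is at most `𝔼 max⁽²⁾{h_1, h_2, h_3}`.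

*Attainment* (`le_obj_changeMechanism`). Order the items `i, j, l` by decreasing index. If
`a_l ≤ c_j`, then `h_i + h_j` is the maximum, whatever `a_i` and `a_j` are, and its mean is
`o_i + o_j`. If `a_l > c_j` and `min(a_j, a_l) ≤ c_i`, then `h_i` is among the two largest, whatever
`a_i` is, and the other one is `max(a_j, a_l)`. Otherwise the two largest values are those of ads. So
the bound is the value of a policy that decides about `i` without knowing `a_i`, and about both `i`
and `j` without knowing `a_i` and `a_j`. The change mechanism of `(i, j)` is the best policy of this
form: its weights compare the conditional means (`integral_integral_virtualContribution`).

*Admissibility* (`changeMechanism_admissible`). Organic display of an item does not depend on its own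
bid (`mem_organicItems_update`), and a displayed ad stays displayed at a higher bid
(`mem_adItems_update`), so the critical bid is a posted price.
-/

namespace Merging

open MeasureTheory Set
open scoped Classical

/-! ### Fresh draws of one bid, and Myerson's identity -/

section Resampling

variable {n : ℕ} {μ : Fin n → Measure ℝ} [∀ i, IsProbabilityMeasure (μ i)]

theorem measurePreserving_update (i : Fin n) :
    MeasurePreserving (fun q : (Fin n → ℝ) × ℝ => Function.update q.1 i q.2)
      ((Measure.pi μ).prod (μ i)) (Measure.pi μ) := by
  have hm : Measurable (fun q : (Fin n → ℝ) × ℝ => Function.update q.1 i q.2) := by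
    rw [measurable_pi_iff]
    intro j
    by_cases h : j = i
    · subst h; simpa using measurable_snd
    · simp only [Function.update_of_ne h]
      exact (measurable_pi_apply j).comp measurable_fst
  refine ⟨hm, ?_⟩
  refine (Measure.pi_eq fun s hs => ?_).symm
  rw [Measure.map_apply hm (MeasurableSet.univ_pi hs)]
  have : (fun q : (Fin n → ℝ) × ℝ => Function.update q.1 i q.2) ⁻¹' univ.pi s
      = (univ.pi (Function.update s i univ)) ×ˢ s i := by
    ext ⟨b, t⟩
    simp only [mem_preimage, mem_pi, mem_univ, true_implies, mem_prod]
    constructor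
    · intro h
      refine ⟨fun j => ?_, by simpa using h i⟩
      by_cases hj : j = i
      · subst hj; simp
      · simpa [Function.update_of_ne hj] using h j
    · rintro ⟨h, ht⟩ j
      by_cases hj : j = i
      · subst hj; simpa using ht
      · simpa [Function.update_of_ne hj] using h j
  rw [this, Measure.prod_prod, Measure.pi_pi, ← Finset.mul_prod_erase _ _ (Finset.mem_univ i),
    ← Finset.mul_prod_erase _ (fun j => μ j (s j)) (Finset.mem_univ i)]
  have h2 : ∀ j ∈ Finset.univ.erase i, μ j (Function.update s i univ j) = μ j (s j) := by
    intro j hj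
    rw [Function.update_of_ne (Finset.ne_of_mem_erase hj)]
  rw [Finset.prod_congr rfl h2]
  simp [mul_comm]

/-- A coordinate of a product law may be replaced by a fresh draw. -/
theorem integral_pi_eq_integral_update (i : Fin n) {F : (Fin n → ℝ) → ℝ}
    (hF : Integrable F (Measure.pi μ)) :
    ∫ b, F b ∂Measure.pi μ = ∫ b, ∫ s, F (Function.update b i s) ∂μ i ∂Measure.pi μ := by
  have h := measurePreserving_update (μ := μ) i
  have hF' : Integrable F (((Measure.pi μ).prod (μ i)).map
      (fun q : (Fin n → ℝ) × ℝ => Function.update q.1 i q.2)) := by rwa [h.map_eq]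
  rw [← integral_prod (fun q : (Fin n → ℝ) × ℝ => F (Function.update q.1 i q.2))
    (hF'.comp_measurable h.measurable)]
  conv_lhs => rw [← h.map_eq]
  exact integral_map h.measurable.aemeasurable hF'.aestronglyMeasurable

theorem integrable_integral_update (i : Fin n) {F : (Fin n → ℝ) → ℝ}
    (hF : Integrable F (Measure.pi μ)) :
    Integrable (fun b => ∫ s, F (Function.update b i s) ∂μ i) (Measure.pi μ) := by
  have h := measurePreserving_update (μ := μ) i
  have hF' : Integrable F (((Measure.pi μ).prod (μ i)).map
      (fun q : (Fin n → ℝ) × ℝ => Function.update q.1 i q.2)) := by rwa [h.map_eq]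
  exact (hF'.comp_measurable h.measurable).integral_prod_left

theorem ae_integrable_update (i : Fin n) {F : (Fin n → ℝ) → ℝ}
    (hF : Integrable F (Measure.pi μ)) :
    ∀ᵐ b ∂Measure.pi μ, Integrable (fun s => F (Function.update b i s)) (μ i) := by
  have h := measurePreserving_update (μ := μ) i
  have hF' : Integrable F (((Measure.pi μ).prod (μ i)).map
      (fun q : (Fin n → ℝ) × ℝ => Function.update q.1 i q.2)) := by rwa [h.map_eq]
  exact (hF'.comp_measurable h.measurable).prod_right_ae

end Resampling

namespace Model

variable {n : ℕ} (E : Model n)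

instance (i : Fin n) : NullSingletonClass (E.law i) :=
  ⟨fun x => (withDensity_absolutelyContinuous _ _) (measure_singleton x)⟩

instance : IsProbabilityMeasure E.jointLaw := by
  unfold jointLaw; infer_instance

theorem law_ae_mem_Icc (i : Fin n) : ∀ᵐ t ∂E.law i, t ∈ Icc 0 (E.B i) := by
  rw [ae_iff]
  change (volume.withDensity _) (Icc 0 (E.B i))ᶜ = 0
  rw [withDensity_apply _ measurableSet_Icc.compl,
    setLIntegral_congr_fun (g := fun _ => 0) measurableSet_Icc.compl
      (fun t ht => by simp [E.f_zero i t ht])]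
  simp

theorem law_ae_mem_Ioo (i : Fin n) : ∀ᵐ t ∂E.law i, t ∈ Ioo 0 (E.B i) := by
  have h0 : ∀ x : ℝ, ∀ᵐ t ∂E.law i, t ≠ x := fun x => by
    rw [ae_iff]; simp
  filter_upwards [E.law_ae_mem_Icc i, h0 0, h0 (E.B i)] with t ht h1 h2
  exact ⟨lt_of_le_of_ne ht.1 h1.symm, lt_of_le_of_ne ht.2 h2⟩

theorem jointLaw_ae_mem_bids : ∀ᵐ b ∂E.jointLaw, b ∈ E.bids := by
  have : ∀ i, ∀ᵐ b ∂E.jointLaw, b i ∈ Icc 0 (E.B i) := fun i =>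
    (measurePreserving_eval E.law i).quasiMeasurePreserving.ae (E.law_ae_mem_Icc i)
  exact (ae_all_iff.2 this)

theorem measurable_virtualValue (i : Fin n) : Measurable (virtualValue (E.f i)) := by
  have hF : Monotone fun t => (densityLaw (E.f i)).real (Iic t) := by
    intro s t hst
    exact measureReal_mono (μ := E.law i) (Iic_subset_Iic.2 hst)
  exact measurable_id.sub ((measurable_const.sub hF.measurable).div (E.f_measurable i))

theorem measurable_adValue (i : Fin n) : Measurable (E.adValue i) :=
  ((E.measurable_virtualValue i).mul_const _).add_const _

theorem integrable_of_monotoneOn {g : ℝ → ℝ} (i : Fin n) (hg : Measurable g)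
    (hmono : MonotoneOn g (Icc 0 (E.B i))) : Integrable g (E.law i) := by
  have hB := E.B_nonneg i
  refine Integrable.of_bound hg.aestronglyMeasurable (max |g 0| |g (E.B i)|) ?_
  filter_upwards [E.law_ae_mem_Icc i] with t ht
  exact abs_le_max_abs_abs (hmono (left_mem_Icc.2 hB) ht ht.1)
    (hmono ht (right_mem_Icc.2 hB) ht.2)

theorem integrable_virtualValue (i : Fin n) : Integrable (virtualValue (E.f i)) (E.law i) :=
  E.integrable_of_monotoneOn i (E.measurable_virtualValue i) (E.regular i)

theorem adValue_monotoneOn (i : Fin n) : MonotoneOn (E.adValue i) (Icc 0 (E.B i)) := by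
  intro s hs t ht hst
  have := mul_le_mul_of_nonneg_right (E.regular i hs ht hst) (E.αA_nonneg i)
  simpa [adValue] using this

theorem integrable_adValue (i : Fin n) : Integrable (E.adValue i) (E.law i) :=
  ((E.integrable_virtualValue i).mul_const _).add (integrable_const _)

theorem integrable_id_law (i : Fin n) : Integrable (fun t : ℝ => t) (E.law i) :=
  E.integrable_of_monotoneOn i measurable_id (monotone_id.monotoneOn _)

/-- Myerson's identity for a posted price: the virtual value of the bids above `τ` has the
expectation of the revenue from the price `τ`. -/
theorem setIntegral_Ici_virtualValue (i : Fin n) {τ : ℝ} (hτ : 0 ≤ τ) :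
    ∫ t in Ici τ, virtualValue (E.f i) t ∂E.law i = τ * (E.law i).real (Ici τ) := by
  have hanti : Antitone fun t => (E.law i).real (Ioi t) := fun s t hst =>
    measureReal_mono (Ioi_subset_Ioi hst)
  have hzero : ∀ t, E.B i ≤ t → (E.law i).real (Ioi t) = 0 := fun t ht => by
    have := E.law_ae_mem_Icc i
    rw [ae_iff] at this
    rw [measureReal_def, measure_mono_null (fun u hu h => ?_) this]
    · simp
    · exact absurd (h.2.trans ht) (not_le.2 hu)
  have hcompl : ∀ t, 1 - (densityLaw (E.f i)).real (Iic t) = (E.law i).real (Ioi t) := fun t => by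
    rw [← compl_Iic, probReal_compl_eq_one_sub measurableSet_Iic]; rfl
  have hfφ : ∀ t, 0 ≤ t → t ≠ E.B i → E.f i t * virtualValue (E.f i) t
      = E.f i t * t - (E.law i).real (Ioi t) := fun t h0 hB => by
    rw [virtualValue, hcompl]
    rcases lt_or_gt_of_ne hB with h | h
    · have := (E.f_pos i t ⟨h0, h⟩).ne'
      field_simp
    · rw [hzero t h.le, E.f_zero i t (fun h' => absurd h'.2 (not_le.2 h))]; simp
  have hdens : ∀ (g : ℝ → ℝ) (s : Set ℝ), MeasurableSet s →
      ∫ t in s, g t ∂E.law i = ∫ t in s, E.f i t * g t := fun g s hs => by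
    unfold law densityLaw
    rw [setIntegral_withDensity_eq_setIntegral_toReal_smul
      (E.f_measurable i).ennreal_ofReal (by simp) _ hs]
    simp [ENNReal.toReal_ofReal (E.f_nonneg i _)]
  have hint : IntegrableOn (fun t => (E.law i).real (Ioi t)) (Ici τ) := by
    have h1 : IntegrableOn (fun t => (E.law i).real (Ioi t)) (Icc τ (E.B i)) :=
      Measure.integrableOn_of_bounded (M := 1) (by simp)
        hanti.measurable.aestronglyMeasurable
        (Filter.Eventually.of_forall fun t => by
          simp [abs_of_nonneg measureReal_nonneg])
    have h2 : IntegrableOn (fun t => (E.law i).real (Ioi t)) (Ioi (E.B i)) :=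
      (integrableOn_zero (s := Ioi (E.B i)) (μ := volume) (ε' := ℝ)).congr_fun
        (fun t ht => (hzero t (le_of_lt ht)).symm) measurableSet_Ioi
    refine (h1.union h2).mono_set fun t ht => ?_
    by_cases h : t ≤ E.B i
    · exact Or.inl ⟨ht, h⟩
    · exact Or.inr (not_le.1 h)
  have hlayer : ∫ t in Ici τ, (t - τ) ∂E.law i = ∫ t in Ici τ, (E.law i).real (Ioi t) := by
    have hi : Integrable (fun t : ℝ => max (t - τ) 0) (E.law i) :=
      ((E.integrable_id_law i).sub (integrable_const τ)).sup (integrable_const 0)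
    have h := hi.integral_eq_integral_meas_lt (Filter.Eventually.of_forall fun t => le_max_right _ _)
    have h1 : ∫ t, max (t - τ) 0 ∂E.law i = ∫ t in Ici τ, (t - τ) ∂E.law i := by
      rw [← integral_indicator measurableSet_Ici]
      congr 1; ext t
      by_cases ht : τ ≤ t
      · simp [indicator, ht]
      · simp [indicator, ht, (not_le.1 ht).le]
    have h2 : ∫ t in Ioi 0, (E.law i).real {a : ℝ | t < max (a - τ) 0}
        = ∫ t in Ioi 0, (E.law i).real (Ioi (t + τ)) := by
      refine setIntegral_congr_fun measurableSet_Ioi fun t ht => ?_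
      have ht' : ¬ t < 0 := not_lt.2 (le_of_lt ht)
      have : {a : ℝ | t < max (a - τ) 0} = Ioi (t + τ) := by
        ext a
        simp [ht', lt_sub_iff_add_lt]
      simp only [this]
    rw [← h1, h, h2, integral_Ici_eq_integral_Ioi]
    have := (measurePreserving_add_right volume τ).setIntegral_preimage_emb
      (measurableEmbedding_addRight τ) (fun t => (E.law i).real (Ioi t)) (Ioi τ)
    simpa using this
  have hid : IntegrableOn (fun t => E.f i t * t) (Ici τ) := by
    have h := E.integrable_id_law i
    unfold law densityLaw at h
    rw [integrable_withDensity_iff_integrable_smul' (E.f_measurable i).ennreal_ofReal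
      (by simp)] at h
    have h' : Integrable (fun t => E.f i t * t) := by
      simpa [ENNReal.toReal_ofReal (E.f_nonneg i _)] using h
    exact h'.integrableOn
  rw [hdens _ _ measurableSet_Ici]
  have hne : ∀ᵐ t : ℝ, t ≠ E.B i := by rw [ae_iff]; simp
  have : ∫ t in Ici τ, E.f i t * virtualValue (E.f i) t
      = ∫ t in Ici τ, (E.f i t * t - (E.law i).real (Ioi t)) := by
    refine setIntegral_congr_ae measurableSet_Ici ?_
    filter_upwards [hne] with t ht h
    exact hfφ t (hτ.trans h) ht
  rw [this, integral_sub hid hint, ← hlayer, ← hdens _ _ measurableSet_Ici,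
    integral_sub (E.integrable_id_law i).integrableOn (integrable_const τ).integrableOn]
  simp [mul_comm]

/-- Myerson's identity for an up-closed set `S` of bids, whose critical bid is `sInf S`. -/
theorem setIntegral_virtualValue (i : Fin n) {S : Set ℝ} (hS : S ⊆ Icc 0 (E.B i))
    (hup : ∀ s ∈ S, ∀ t ∈ Icc 0 (E.B i), s ≤ t → t ∈ S) :
    ∫ t in S, virtualValue (E.f i) t ∂E.law i = sInf S * (E.law i).real S := by
  rcases S.eq_empty_or_nonempty with rfl | hne
  · simp
  have hbdd : BddBelow S := ⟨0, fun t ht => (hS ht).1⟩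
  have h0 : 0 ≤ sInf S := le_csInf hne fun t ht => (hS ht).1
  have hae : S =ᵐ[E.law i] Ici (sInf S) := by
    have hne' : ∀ᵐ t ∂E.law i, t ≠ sInf S := by rw [ae_iff]; simp
    filter_upwards [hne', E.law_ae_mem_Icc i] with t ht hI
    refine propext ⟨fun h => csInf_le hbdd h, fun h => ?_⟩
    obtain ⟨s, hs, hst⟩ := exists_lt_of_csInf_lt hne (lt_of_le_of_ne h ht.symm)
    exact hup s hs t hI hst.le
  rw [setIntegral_congr_set hae, measureReal_congr hae, E.setIntegral_Ici_virtualValue i h0]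

end Model

/-! ### Sums of the largest values -/

section TopSum

variable {n : ℕ} {m : ℕ} {S T : Finset (Fin n)} {a : Fin n → ℝ}

theorem finite_topSum_range (m : ℕ) (S : Finset (Fin n)) (a : Fin n → ℝ) :
    ((fun T : Finset (Fin n) => ∑ i ∈ T, a i) '' {T | T ⊆ S ∧ T.card = m}).Finite :=
  (Set.toFinite _).image _

theorem sum_le_topSum (hT : T ⊆ S) (hm : T.card = m) : ∑ i ∈ T, a i ≤ topSum m S a :=
  le_csSup (finite_topSum_range m S a).bddAbove ⟨T, ⟨hT, hm⟩, rfl⟩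

theorem topSum_le (hm : m ≤ S.card) {C : ℝ}
    (h : ∀ T ⊆ S, T.card = m → ∑ i ∈ T, a i ≤ C) : topSum m S a ≤ C := by
  obtain ⟨T, hT, hc⟩ := Finset.exists_subset_card_eq hm
  refine csSup_le ⟨_, T, ⟨hT, hc⟩, rfl⟩ ?_
  rintro _ ⟨T, ⟨hT, hc⟩, rfl⟩
  exact h T hT hc

/-- The number of items of `S` ranked above `i`, when items are ranked by decreasing `a` and
equal values by index. -/
noncomputable def rankIn (S : Finset (Fin n)) (a : Fin n → ℝ) (i : Fin n) : ℕ :=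
  (S.filter fun j => a i < a j ∨ (a j = a i ∧ j < i)).card

/-- The `m` highest ranked items of `S` (all of `S` if it has fewer items). -/
noncomputable def leaders (m : ℕ) (S : Finset (Fin n)) (a : Fin n → ℝ) : Finset (Fin n) :=
  S.filter fun i => rankIn S a i < m

theorem rankIn_lt_rankIn {i j : Fin n} (hi : i ∈ S) (h : a j < a i ∨ (a i = a j ∧ i < j)) :
    rankIn S a i < rankIn S a j := by
  refine Finset.card_lt_card (Finset.ssubset_iff_subset_ne.2 ⟨fun l hl => ?_, fun he => ?_⟩)
  · simp only [Finset.mem_filter] at hl ⊢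
    refine ⟨hl.1, ?_⟩
    rcases h with h | ⟨h, hij⟩ <;> rcases hl.2 with h' | ⟨h', hli⟩
    · exact Or.inl (h.trans h')
    · exact Or.inl (h' ▸ h)
    · exact Or.inl (h ▸ h')
    · exact Or.inr ⟨h'.trans h, hli.trans hij⟩
  · have : i ∈ S.filter fun l => a j < a l ∨ (a l = a j ∧ l < j) := by
      simp [hi, h]
    rw [← he] at this
    simp at this

theorem rankIn_injOn : Set.InjOn (rankIn S a) S := by
  intro i hi j hj h
  by_contra hne
  rcases lt_trichotomy (a i) (a j) with h1 | h1 | h1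
  · exact (rankIn_lt_rankIn hj (Or.inl h1)).ne' h
  · rcases lt_or_gt_of_ne hne with h2 | h2
    · exact (rankIn_lt_rankIn hi (Or.inr ⟨h1, h2⟩)).ne h
    · exact (rankIn_lt_rankIn hj (Or.inr ⟨h1.symm, h2⟩)).ne' h
  · exact (rankIn_lt_rankIn hi (Or.inl h1)).ne h

theorem image_rankIn : S.image (rankIn S a) = Finset.range S.card := by
  refine Finset.eq_of_subset_of_card_le (fun r hr => ?_) ?_
  · obtain ⟨i, hi, rfl⟩ := Finset.mem_image.1 hr
    refine Finset.mem_range.2 (Finset.card_lt_card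
      (Finset.ssubset_iff_subset_ne.2 ⟨Finset.filter_subset _ _, fun he => ?_⟩))
    rw [← he] at hi
    simp at hi
  · rw [Finset.card_range, Finset.card_image_of_injOn rankIn_injOn]

theorem card_leaders (hm : m ≤ S.card) : (leaders m S a).card = m := by
  have h1 : (leaders m S a).image (rankIn S a) = Finset.range m := by
    ext r
    simp only [leaders, Finset.mem_image, Finset.mem_filter, Finset.mem_range]
    constructor
    · rintro ⟨i, ⟨_, h⟩, rfl⟩
      exact h
    · intro hr
      have : r ∈ S.image (rankIn S a) := by
        rw [image_rankIn]; exact Finset.mem_range.2 (hr.trans_le hm)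
      obtain ⟨i, hi, rfl⟩ := Finset.mem_image.1 this
      exact ⟨i, ⟨hi, hr⟩, rfl⟩
  rw [← Finset.card_image_of_injOn (rankIn_injOn.mono (Finset.filter_subset _ _) :
    Set.InjOn (rankIn S a) (leaders m S a)), h1, Finset.card_range]

/-- Exchange argument: no item outside `leaders` has a larger value than an item inside. -/
theorem sum_leaders (hm : m ≤ S.card) : ∑ i ∈ leaders m S a, a i = topSum m S a := by
  refine le_antisymm (sum_le_topSum (Finset.filter_subset _ _) (card_leaders hm))
    (topSum_le hm fun T hT hc => ?_)
  set A := leaders m S a with hA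
  have hAc : A.card = m := card_leaders hm
  have hle : ∀ i ∈ T \ A, ∀ j ∈ A \ T, a i ≤ a j := by
    intro i hi j hj
    rw [Finset.mem_sdiff] at hi hj
    have hjA := Finset.mem_filter.1 hj.1
    by_contra! hlt
    have h1 : rankIn S a i < rankIn S a j := rankIn_lt_rankIn (hT hi.1) (Or.inl hlt)
    exact hi.2 (Finset.mem_filter.2 ⟨hT hi.1, h1.trans hjA.2⟩)
  have hcard : (T \ A).card = (A \ T).card := Finset.card_sdiff_comm (hc.trans hAc.symm)
  have hmain : ∑ i ∈ T \ A, a i ≤ ∑ i ∈ A \ T, a i := by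
    rcases (A \ T).eq_empty_or_nonempty with he | hne
    · rw [he, Finset.card_empty, Finset.card_eq_zero] at hcard
      rw [hcard, he]
    · obtain ⟨j, hj, hmin⟩ := Finset.exists_min_image _ a hne
      calc ∑ i ∈ T \ A, a i ≤ (T \ A).card • a j :=
            Finset.sum_le_card_nsmul _ _ _ fun i hi => hle i hi j hj
        _ = (A \ T).card • a j := by rw [hcard]
        _ ≤ ∑ i ∈ A \ T, a i := Finset.card_nsmul_le_sum _ _ _ hmin
  rw [← Finset.sum_inter_add_sum_sdiff T A, ← Finset.sum_inter_add_sum_sdiff A T,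
    Finset.inter_comm A T]
  linarith

/-- An item keeps its place among the leaders when its own value rises and each further
competitor comes with a further place. -/
theorem mem_leaders_of_le {m' : ℕ} {S' : Finset (Fin n)} {a' : Fin n → ℝ} {i : Fin n}
    (hi : i ∈ leaders m S a) (hS : S ⊆ S') (hm : (S' \ S).card + m ≤ m')
    (hai : a i ≤ a' i) (ha : ∀ j ≠ i, a' j = a j) : i ∈ leaders m' S' a' := by
  obtain ⟨hiS, hr⟩ := Finset.mem_filter.1 hi
  refine Finset.mem_filter.2 ⟨hS hiS, ?_⟩
  have hsub : (S'.filter fun j => a' i < a' j ∨ (a' j = a' i ∧ j < i))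
      ⊆ (S.filter fun j => a i < a j ∨ (a j = a i ∧ j < i)) ∪ (S' \ S) := by
    intro j hj
    obtain ⟨hj, hb⟩ := Finset.mem_filter.1 hj
    by_cases hjS : j ∈ S
    · refine Finset.mem_union_left _ (Finset.mem_filter.2 ⟨hjS, ?_⟩)
      have hji : j ≠ i := by rintro rfl; simp at hb
      rw [ha j hji] at hb
      rcases hb with hb | ⟨hb, hlt⟩
      · exact Or.inl (hai.trans_lt hb)
      · rcases (hai.trans hb.ge).lt_or_eq with h | h
        · exact Or.inl h
        · exact Or.inr ⟨h.symm, hlt⟩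
    · exact Finset.mem_union_right _ (Finset.mem_sdiff.2 ⟨hj, hjS⟩)
  have := (Finset.card_le_card hsub).trans (Finset.card_union_le _ _)
  unfold rankIn at hr ⊢
  omega

theorem topSum_zero (S : Finset (Fin n)) (a : Fin n → ℝ) : topSum 0 S a = 0 := by
  rw [← sum_leaders (Nat.zero_le _), Finset.card_eq_zero.1 (card_leaders (Nat.zero_le _)),
    Finset.sum_empty]

theorem topSum_one_pair {j l : Fin n} (h : j ≠ l) (a : Fin n → ℝ) :
    topSum 1 {j, l} a = max (a j) (a l) := by
  refine le_antisymm (topSum_le (by simp [Finset.card_pair h]) fun T hT hc => ?_)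
    (max_le ?_ ?_)
  · obtain ⟨i, rfl⟩ := Finset.card_eq_one.1 hc
    simp only [Finset.singleton_subset_iff, Finset.mem_insert, Finset.mem_singleton] at hT
    rcases hT with rfl | rfl <;> simp
  · simpa using sum_le_topSum (m := 1) (T := {j}) (S := {j, l}) (a := a) (by simp) (by simp)
  · simpa using sum_le_topSum (m := 1) (T := {l}) (S := {j, l}) (a := a) (by simp) (by simp)

theorem topSum_two_univ {i j l : Fin 3} (hij : i ≠ j) (hil : i ≠ l) (hjl : j ≠ l)
    (a : Fin 3 → ℝ) :
    topSum 2 Finset.univ a = max (a j) (a l) + max (a i) (min (a j) (a l)) := by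
  have huniv : (Finset.univ : Finset (Fin 3)) = {i, j, l} := by
    symm; rw [← Finset.card_eq_iff_eq_univ, Finset.card_eq_three.2 ⟨i, j, l, hij, hil, hjl, rfl⟩]
    simp
  have key : ∀ p q : Fin 3, p ≠ q → a p + a q ≤ topSum 2 Finset.univ a := fun p q h => by
    simpa [Finset.sum_pair h] using sum_le_topSum (m := 2) (T := {p, q}) (S := Finset.univ) (a := a)
      (by simp) (Finset.card_pair h)
  refine le_antisymm (topSum_le (by simp) fun T _ hc => ?_) ?_
  · obtain ⟨p, q, hpq, rfl⟩ := Finset.card_eq_two.1 hc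
    rw [Finset.sum_pair hpq]
    have hp : p ∈ ({i, j, l} : Finset (Fin 3)) := huniv ▸ Finset.mem_univ p
    have hq : q ∈ ({i, j, l} : Finset (Fin 3)) := huniv ▸ Finset.mem_univ q
    simp only [Finset.mem_insert, Finset.mem_singleton] at hp hq
    rcases hp with rfl | rfl | rfl <;> rcases hq with rfl | rfl | rfl <;>
      first
      | exact absurd rfl hpq
      | grind
  · have h1 := key i j hij
    have h2 := key i l hil
    have h3 := key j l hjl
    grind

end TopSum

/-! ### The threshold and the displayed items of a change mechanism -/

namespace Model

section General

variable {n k : ℕ} (E : Model n) (I : Fin k ↪ Fin n)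

/-- The requirement on the later positions in the definition of `s*` only singles out the last
position that passes its own test. -/
theorem lt_sStar_iff (a : Fin n → ℝ) (j : Fin k) :
    (j : ℕ) < E.sStar I a ↔ ∃ s : Fin k, j ≤ s ∧ E.w I s s.isLt a ≤ E.γO (I s) := by
  unfold sStar
  rw [Finset.lt_sup_iff]
  constructor
  · rintro ⟨s, hs, hj⟩
    exact ⟨s, Fin.le_def.2 (by omega), (Finset.mem_filter.1 hs).2.2⟩
  · rintro ⟨s, hjs, hs⟩
    have hne : (Finset.univ.filter fun s : Fin k => E.w I s s.isLt a ≤ E.γO (I s)).Nonempty :=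
      ⟨s, by simp [hs]⟩
    obtain ⟨m, hm, hmax⟩ := Finset.exists_max_image _ id hne
    simp only [Finset.mem_filter, Finset.mem_univ, true_and, id] at hm hmax
    refine ⟨m, ?_, ?_⟩
    · simp only [Finset.mem_filter, Finset.mem_univ, true_and]
      refine ⟨fun t ht => ?_, hm⟩
      by_contra! hc
      exact absurd (hmax t hc) (not_le.2 ht)
    · have := Fin.le_def.1 (hjs.trans (hmax s hs))
      omega

theorem sStar_le (a : Fin n → ℝ) : E.sStar I a ≤ k :=
  Finset.sup_le fun s _ => s.isLt

theorem card_firstItems {m : ℕ} (hm : m ≤ k) : (firstItems I m).card = m := by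
  rw [firstItems, Finset.card_map, Fin.card_filter_val_lt]
  exact min_eq_right hm

theorem adItems_eq_leaders (a : Fin n → ℝ) :
    E.adItems I a = leaders (k - E.sStar I a) (E.organicItems I a)ᶜ a := by
  have : (E.organicItems I a)ᶜ = Finset.univ.filter fun j => j ∉ E.organicItems I a := by
    ext; simp
  ext i
  simp only [adItems, leaders, rankIn, this, Finset.filter_filter]

theorem card_compl_organicItems (a : Fin n → ℝ) :
    k - E.sStar I a ≤ (E.organicItems I a)ᶜ.card := by
  have h := card_firstItems I (E.sStar_le I a)
  have hk : k ≤ n := by simpa using Fintype.card_le_of_embedding I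
  rw [Finset.card_compl, organicItems, h, Fintype.card_fin]
  omega

theorem disjoint_adItems {a : Fin n → ℝ} {m : Fin n} (h : m ∈ E.adItems I a) :
    m ∉ E.organicItems I a := (Finset.mem_filter.1 h).2.1

/-- If the ad value of `m` rises and `s*` drops from `s` to `s'`, then `s - s'` places and as many
competitors are added, so that a displayed ad remains displayed. -/
theorem mem_adItems_of_le {a a' : Fin n → ℝ} {m : Fin n} (h : m ∈ E.adItems I a)
    (hs : E.sStar I a' ≤ E.sStar I a) (hm : a m ≤ a' m) (ha : ∀ j ≠ m, a' j = a j) :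
    m ∈ E.adItems I a' := by
  rw [adItems_eq_leaders] at h ⊢
  have hsub : E.organicItems I a' ⊆ E.organicItems I a := by
    refine Finset.map_subset_map.2 fun t ht => ?_
    simp only [Finset.mem_filter, Finset.mem_univ, true_and] at ht ⊢
    omega
  refine mem_leaders_of_le h (Finset.compl_subset_compl.2 hsub) ?_ hm ha
  have : (E.organicItems I a')ᶜ \ (E.organicItems I a)ᶜ
      = E.organicItems I a \ E.organicItems I a' := by
    ext; simp [and_comm]
  rw [this, Finset.card_sdiff_of_subset hsub, organicItems, organicItems,
    card_firstItems I (E.sStar_le I a), card_firstItems I (E.sStar_le I a')]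
  have := E.sStar_le I a
  omega

theorem adValues_update (b : Fin n → ℝ) (m : Fin n) (t : ℝ) :
    E.adValues (Function.update b m t) = Function.update (E.adValues b) m (E.adValue m t) := by
  ext j
  by_cases h : j = m
  · subst h; simp [adValues]
  · simp [adValues, Function.update_of_ne h]

theorem measurable_adValues : Measurable E.adValues :=
  measurable_pi_iff.2 fun i => (E.measurable_adValue i).comp (measurable_pi_apply i)

theorem measurableSet_mem_leaders (m : ℕ) (S : Finset (Fin n)) (i : Fin n) :
    MeasurableSet {a : Fin n → ℝ | i ∈ leaders m S a} := by
  by_cases hi : i ∈ S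
  · have : Measurable fun a : Fin n → ℝ => rankIn S a i := by
      simp only [rankIn, Finset.card_filter]
      refine Finset.measurable_sum _ fun j _ => ?_
      refine Measurable.ite ?_ measurable_const measurable_const
      exact (measurableSet_lt (measurable_pi_apply i) (measurable_pi_apply j)).union
        ((measurableSet_eq_fun (measurable_pi_apply j) (measurable_pi_apply i)).inter
          (MeasurableSet.const _))
    simp only [leaders, Finset.mem_filter, hi, true_and]
    exact this (measurableSet_Iio (a := m))
  · simp [leaders, hi]

variable {E I}

theorem measurableSet_mem_organicItems (hs : Measurable (E.sStar I)) (m : Fin n) :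
    MeasurableSet {a | m ∈ E.organicItems I a} :=
  hs (MeasurableSet.of_discrete (s := {r | m ∈ firstItems I r}))

theorem measurableSet_mem_adItems (hs : Measurable (E.sStar I)) (m : Fin n) :
    MeasurableSet {a | m ∈ E.adItems I a} := by
  have : {a | m ∈ E.adItems I a}
      = ⋃ r : ℕ, {a | E.sStar I a = r} ∩ {a | m ∈ leaders (k - r) (firstItems I r)ᶜ a} := by
    ext a
    simp [adItems_eq_leaders, organicItems]
  rw [this]
  exact MeasurableSet.iUnion fun r =>
    (hs (measurableSet_singleton r)).inter (measurableSet_mem_leaders _ _ _)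

end General

section OneSlotLeft

variable {n : ℕ} (E : Model n)

/-- The mean of `max a_i u`. -/
noncomputable def meanMax (i : Fin n) (u : ℝ) : ℝ := ∫ t, max (E.adValue i t) u ∂E.law i

theorem integrable_max_adValue (i : Fin n) (u : ℝ) :
    Integrable (fun t => max (E.adValue i t) u) (E.law i) :=
  (E.integrable_adValue i).sup (integrable_const u)

theorem meanMax_mono (i : Fin n) : Monotone (E.meanMax i) := fun u v h =>
  integral_mono (E.integrable_max_adValue i u) (E.integrable_max_adValue i v)
    fun _ => max_le_max le_rfl h

theorem meanMax_le_add (i : Fin n) (u v : ℝ) : E.meanMax i u ≤ E.meanMax i v + |u - v| := by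
  have : E.meanMax i v + |u - v| = ∫ t, (max (E.adValue i t) v + |u - v|) ∂E.law i := by
    rw [integral_add (E.integrable_max_adValue i v) (integrable_const _)]
    simp [meanMax]
  rw [this]
  refine integral_mono (E.integrable_max_adValue i u)
    ((E.integrable_max_adValue i v).add (integrable_const _)) fun t => ?_
  have h1 := le_abs_self (u - v)
  have h2 := abs_nonneg (u - v)
  have h3 := le_max_left (E.adValue i t) v
  have h4 := le_max_right (E.adValue i t) v
  exact max_le (by dsimp only; linarith) (by dsimp only; linarith)

theorem continuous_meanMax (i : Fin n) : Continuous (E.meanMax i) := by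
  refine (LipschitzWith.of_le_add fun u v => ?_).continuous
  simpa [Real.dist_eq] using E.meanMax_le_add i u v

theorem integrable_meanMax_comp {Ω : Type*} [MeasurableSpace Ω] {μ : Measure Ω}
    [IsFiniteMeasure μ] (i : Fin n) {u : Ω → ℝ} (hu : Integrable u μ) :
    Integrable (fun x => E.meanMax i (u x)) μ := by
  refine Integrable.mono' (g := fun x => |E.meanMax i 0| + |u x|)
    ((integrable_const _).add hu.abs)
    ((E.continuous_meanMax i).comp_aestronglyMeasurable hu.aestronglyMeasurable)
    (Filter.Eventually.of_forall fun x => ?_)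
  have h1 := E.meanMax_le_add i (u x) 0
  have h2 := E.meanMax_le_add i 0 (u x)
  rw [sub_zero] at h1
  rw [zero_sub, abs_neg] at h2
  have h3 := le_abs_self (E.meanMax i 0)
  have h4 := neg_abs_le (E.meanMax i 0)
  exact abs_le.2 ⟨by linarith, by linarith⟩

/-- With three items and two slots, ad values `v` and `u` of the other two items: the better of the
mean values of showing `i` organically beside the best other ad, and of showing the two best ads.
In the second case the best other ad is displayed anyway, and the mean of the remaining slot is
`meanMax i (min v u)`. -/
noncomputable def organicGain (i : Fin n) (v u : ℝ) : ℝ :=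
  max v u + max (E.γO i) (E.meanMax i (min v u))

/-- The mean of `organicGain` over the ad value of `j`: the expected value of leaving `j` out of
the organic items when the third item has ad value `u`. -/
noncomputable def organicMean (i j : Fin n) (u : ℝ) : ℝ :=
  ∫ t, E.organicGain i (E.adValue j t) u ∂E.law j

theorem integrable_organicGain (i j : Fin n) (u : ℝ) :
    Integrable (fun t => E.organicGain i (E.adValue j t) u) (E.law j) :=
  (E.integrable_max_adValue j u).add ((integrable_const _).sup
    (E.integrable_meanMax_comp i ((E.integrable_adValue j).inf (integrable_const u))))

theorem organicGain_mono (i : Fin n) {v v' u u' : ℝ} (hv : v ≤ v') (hu : u ≤ u') :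
    E.organicGain i v u ≤ E.organicGain i v' u' :=
  add_le_add (max_le_max hv hu) (max_le_max le_rfl (E.meanMax_mono i (min_le_min hv hu)))

theorem organicMean_mono (i j : Fin n) : Monotone (E.organicMean i j) := fun u v h =>
  integral_mono (E.integrable_organicGain i j u) (E.integrable_organicGain i j v)
    fun _ => E.organicGain_mono i le_rfl h

end OneSlotLeft

section ThreeItems

variable (E : Model 3) (I : Fin 2 ↪ Fin 3)

theorem firstItems_one : firstItems I 1 = {I 0} := by
  ext m
  simp [firstItems, eq_comm]

theorem firstItems_two : firstItems I 2 = {I 0, I 1} := by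
  ext m
  simp [firstItems, Fin.exists_fin_two, eq_comm]

theorem firstItems_zero : firstItems I 0 = ∅ := by
  simp [firstItems]

variable {I} {l : Fin 3}

theorem univ_eq_items (h0 : l ≠ I 0) (h1 : l ≠ I 1) :
    (Finset.univ : Finset (Fin 3)) = {I 0, I 1, l} := by
  have h : I 0 ≠ I 1 := I.injective.ne (by decide)
  symm
  rw [← Finset.card_eq_iff_eq_univ, Finset.card_eq_three.2 ⟨_, _, l, h, h0.symm, h1.symm, rfl⟩]
  simp

theorem eq_item (h0 : l ≠ I 0) (h1 : l ≠ I 1) (m : Fin 3) : m = I 0 ∨ m = I 1 ∨ m = l := by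
  have : m ∈ ({I 0, I 1, l} : Finset (Fin 3)) := univ_eq_items h0 h1 ▸ Finset.mem_univ m
  simpa using this

theorem compl_firstItems_one (h0 : l ≠ I 0) (h1 : l ≠ I 1) : (firstItems I 1)ᶜ = {I 1, l} := by
  have h : I 0 ≠ I 1 := I.injective.ne (by decide)
  ext m
  rw [firstItems_one]
  rcases eq_item h0 h1 m with rfl | rfl | rfl <;> simp [h, h0, h1, h.symm, h0.symm]

theorem topSum_two_items (h0 : l ≠ I 0) (h1 : l ≠ I 1) (a : Fin 3 → ℝ) : topSum 2 Finset.univ a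
    = max (a (I 1)) (a l) + max (a (I 0)) (min (a (I 1)) (a l)) :=
  topSum_two_univ (I.injective.ne (by decide)) h0.symm h1.symm a

theorem R_zero (h0 : l ≠ I 0) (h1 : l ≠ I 1) (a : Fin 3 → ℝ) : E.R I 0 a = max (a (I 1)) (a l) := by
  have : topSum (2 - (((0 : Fin 2) : ℕ) + 1)) (firstItems I (((0 : Fin 2) : ℕ) + 1))ᶜ a
      = topSum 1 {I 1, l} a := by
    rw [← compl_firstItems_one h0 h1]; rfl
  rw [R, this, topSum_one_pair h1.symm]
  simp

theorem R_one (a : Fin 3 → ℝ) : E.R I 1 a = E.γO (I 0) := by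
  have : topSum (2 - (((1 : Fin 2) : ℕ) + 1)) (firstItems I (((1 : Fin 2) : ℕ) + 1))ᶜ a = 0 :=
    topSum_zero _ _
  have h2 : (Finset.univ.filter fun j : Fin 2 => j < 1) = {0} := by decide
  rw [R, this, h2]
  simp

theorem w_zero (h0 : l ≠ I 0) (h1 : l ≠ I 1) (h : 0 < 2) (a : Fin 3 → ℝ) :
    E.w I 0 h a = E.meanMax (I 0) (min (a (I 1)) (a l)) := by
  have hi : I 1 ≠ I 0 := I.injective.ne (by decide)
  have hR := E.R_zero h0 h1 a
  have h2 : (fun s => topSum 2 Finset.univ (Function.update a (I 0) s))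
      = fun s => max (a (I 1)) (a l) + max s (min (a (I 1)) (a l)) := by
    ext s
    rw [topSum_two_items h0 h1]
    simp [Function.update_of_ne h0]
  have h3 : E.w I 0 h a
      = (∫ s, topSum 2 Finset.univ (Function.update a (I 0) s) ∂E.adLaw (I 0)) - E.R I 0 a := rfl
  rw [h3, h2, hR, adLaw, integral_map (E.measurable_adValue _).aemeasurable
    (by fun_prop), integral_add (integrable_const _) (E.integrable_max_adValue _ _)]
  simp [meanMax]

theorem w_one (h0 : l ≠ I 0) (h1 : l ≠ I 1) (h : 1 < 2) (a : Fin 3 → ℝ) :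
    E.w I 1 h a = E.organicMean (I 0) (I 1) (a l) - E.γO (I 0) := by
  have h3 : E.w I 1 h a = (∫ s, max
      (E.γO (I 0) + E.R I 0 (Function.update a (I 1) s))
      (E.w I 0 (by omega) (Function.update a (I 1) s) + E.R I 0 (Function.update a (I 1) s))
        ∂E.adLaw (I 1)) - E.R I 1 a := rfl
  have h2 : (fun s => max
      (E.γO (I 0) + E.R I 0 (Function.update a (I 1) s))
      (E.w I 0 (by omega) (Function.update a (I 1) s) + E.R I 0 (Function.update a (I 1) s)))
      = fun s => E.organicGain (I 0) s (a l) := by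
    ext s
    rw [E.R_zero h0 h1, E.w_zero h0 h1, organicGain, max_add_add_right, add_comm]
    simp [Function.update_of_ne h1]
  have hm : Measurable fun s => E.organicGain (I 0) s (a l) :=
    Monotone.measurable fun s t hst => E.organicGain_mono _ hst le_rfl
  rw [h3, h2, R_one, adLaw, integral_map (E.measurable_adValue _).aemeasurable
    hm.aestronglyMeasurable]
  rfl

theorem one_lt_sStar_iff (h0 : l ≠ I 0) (h1 : l ≠ I 1) (a : Fin 3 → ℝ) : 1 < E.sStar I a
    ↔ E.organicMean (I 0) (I 1) (a l) ≤ E.γO (I 0) + E.γO (I 1) := by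
  have h := E.lt_sStar_iff I a 1
  rw [Fin.exists_fin_two] at h
  have h2 : E.w I (1 : Fin 2) (1 : Fin 2).isLt a
      = E.organicMean (I 0) (I 1) (a l) - E.γO (I 0) := E.w_one h0 h1 (by omega) a
  rw [h2] at h
  have h3 : ((1 : Fin 2) : ℕ) = 1 := rfl
  rw [h3] at h
  rw [h]
  simp [add_comm]

theorem sStar_pos_iff (h0 : l ≠ I 0) (h1 : l ≠ I 1) (a : Fin 3 → ℝ) : 0 < E.sStar I a
    ↔ E.meanMax (I 0) (min (a (I 1)) (a l)) ≤ E.γO (I 0) ∨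
      E.organicMean (I 0) (I 1) (a l) ≤ E.γO (I 0) + E.γO (I 1) := by
  have h := E.lt_sStar_iff I a 0
  rw [Fin.exists_fin_two] at h
  have h2 : E.w I (1 : Fin 2) (1 : Fin 2).isLt a
      = E.organicMean (I 0) (I 1) (a l) - E.γO (I 0) := E.w_one h0 h1 (by omega) a
  have h4 : E.w I (0 : Fin 2) (0 : Fin 2).isLt a
      = E.meanMax (I 0) (min (a (I 1)) (a l)) := E.w_zero h0 h1 (by omega) a
  rw [h2, h4] at h
  have h3 : ((0 : Fin 2) : ℕ) = 0 := rfl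
  rw [h3] at h
  rw [h]
  simp [add_comm]

end ThreeItems

section ThreeItemsChange

variable (E : Model 3) (I : Fin 2 ↪ Fin 3)

theorem exists_third : ∃ l : Fin 3, l ≠ I 0 ∧ l ≠ I 1 := by
  generalize I 0 = i
  generalize I 1 = j
  revert i j
  decide

theorem measurable_sStar : Measurable (E.sStar I) := by
  obtain ⟨l, h0, h1⟩ := exists_third I
  have hs : E.sStar I = fun a =>
      (if 0 < E.sStar I a then 1 else 0) + (if 1 < E.sStar I a then 1 else 0) := by
    ext a
    have : E.sStar I a ≤ 2 := E.sStar_le I a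
    split_ifs <;> omega
  rw [hs]
  have hW : MeasurableSet {a : Fin 3 → ℝ |
      E.organicMean (I 0) (I 1) (a l) ≤ E.γO (I 0) + E.γO (I 1)} :=
    measurableSet_le ((E.organicMean_mono _ _).measurable.comp (measurable_pi_apply l))
      measurable_const
  have hg : MeasurableSet {a : Fin 3 → ℝ |
      E.meanMax (I 0) (min (a (I 1)) (a l)) ≤ E.γO (I 0)} :=
    measurableSet_le ((E.continuous_meanMax _).measurable.comp
      ((measurable_pi_apply _).min (measurable_pi_apply l))) measurable_const
  refine Measurable.add (Measurable.ite ?_ measurable_const measurable_const)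
    (Measurable.ite ?_ measurable_const measurable_const)
  · simp only [E.sStar_pos_iff h0 h1]
    exact hg.union hW
  · simp only [E.one_lt_sStar_iff h0 h1]
    exact hW

/-- For two slots the weights are monotone in the ad values of the other items. -/
theorem sStar_anti : Antitone (E.sStar I) := by
  intro a a' h
  obtain ⟨l, h0, h1⟩ := exists_third I
  have h2 : 0 < E.sStar I a' → 0 < E.sStar I a := by
    rw [E.sStar_pos_iff h0 h1, E.sStar_pos_iff h0 h1]
    exact Or.imp (E.meanMax_mono _ (min_le_min (h _) (h _))).trans
      (E.organicMean_mono _ _ (h l)).trans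
  have h3 : 1 < E.sStar I a' → 1 < E.sStar I a := by
    rw [E.one_lt_sStar_iff h0 h1, E.one_lt_sStar_iff h0 h1]
    exact (E.organicMean_mono _ _ (h l)).trans
  have : E.sStar I a' ≤ 2 := E.sStar_le I a'
  omega

/-- Whether an item is displayed organically does not depend on its own ad value, since the weight
`w` of a position averages over the ad values of that position and the earlier ones. -/
theorem mem_organicItems_update (a : Fin 3 → ℝ) (m : Fin 3) (v : ℝ) :
    m ∈ E.organicItems I (Function.update a m v) ↔ m ∈ E.organicItems I a := by
  obtain ⟨l, h0, h1⟩ := exists_third I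
  have hi : I 1 ≠ I 0 := I.injective.ne (by decide)
  rcases eq_item h0 h1 m with rfl | rfl | rfl
  · have this : ∀ a, I 0 ∈ E.organicItems I a ↔ 0 < E.sStar I a := by
      simp [organicItems, firstItems]
    rw [this, this, E.sStar_pos_iff h0 h1, E.sStar_pos_iff h0 h1]
    simp [Function.update_of_ne h0]
  · have this : ∀ a, I 1 ∈ E.organicItems I a ↔ 1 < E.sStar I a := by
      simp [organicItems, firstItems]
    rw [this, this, E.one_lt_sStar_iff h0 h1, E.one_lt_sStar_iff h0 h1]
    simp [Function.update_of_ne h1]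
  · have this : ∀ a, m ∉ E.organicItems I a := by
      simp [organicItems, firstItems, Fin.exists_fin_two, h0.symm, h1.symm]
    simp [this]

theorem mem_adItems_update {a : Fin 3 → ℝ} {m : Fin 3} {v : ℝ} (h : m ∈ E.adItems I a)
    (hv : a m ≤ v) : m ∈ E.adItems I (Function.update a m v) := by
  refine E.mem_adItems_of_le I h (E.sStar_anti I ?_) (by simpa using hv)
    fun j hj => Function.update_of_ne hj _ _
  exact le_update_iff.2 ⟨hv, fun _ _ => le_rfl⟩

end ThreeItemsChange

end Model

/-! ### The change mechanism is admissible; its objective -/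

namespace Model

variable (E : Model 3) (I : Fin 2 ↪ Fin 3)

/-- The own bids at which the ad of item `m` is displayed. -/
def winningBids (b : Fin 3 → ℝ) (m : Fin 3) : Set ℝ :=
  {t | t ∈ Icc 0 (E.B m) ∧ m ∈ E.adItems I (E.adValues (Function.update b m t))}

theorem winningBids_update (b : Fin 3 → ℝ) (m : Fin 3) (s : ℝ) :
    E.winningBids I (Function.update b m s) m = E.winningBids I b m := by
  simp [winningBids]

theorem winningBids_upper {b : Fin 3 → ℝ} {m : Fin 3} :
    ∀ s ∈ E.winningBids I b m, ∀ t ∈ Icc 0 (E.B m), s ≤ t → t ∈ E.winningBids I b m := by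
  rintro s ⟨hs, hw⟩ t ht hst
  refine ⟨ht, ?_⟩
  have := E.mem_adItems_update I (v := E.adValue m t) hw
    (by simpa [adValues] using E.adValue_monotoneOn m hs ht hst)
  rw [adValues_update, Function.update_idem] at this
  rwa [adValues_update]

theorem sInf_winningBids_mem (b : Fin 3 → ℝ) (m : Fin 3) :
    sInf (E.winningBids I b m) ∈ Icc 0 (E.B m) := by
  rcases (E.winningBids I b m).eq_empty_or_nonempty with h | ⟨t, ht⟩
  · simp [h, E.B_nonneg m]
  · exact ⟨le_csInf ⟨t, ht⟩ fun s hs => hs.1.1,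
      (csInf_le ⟨0, fun s hs => hs.1.1⟩ ht).trans ht.1.2⟩

theorem measurableSet_mem_adItems_adValues (m : Fin 3) :
    MeasurableSet {b : Fin 3 → ℝ | m ∈ E.adItems I (E.adValues b)} :=
  E.measurable_adValues (measurableSet_mem_adItems (E.measurable_sStar I) m)

theorem measurableSet_mem_winningBids (m : Fin 3) (t : ℝ) :
    MeasurableSet {b : Fin 3 → ℝ | t ∈ E.winningBids I b m} := by
  have hu : Measurable fun b : Fin 3 → ℝ => Function.update b m t := measurable_update_left
  exact (MeasurableSet.const _).inter (hu (E.measurableSet_mem_adItems_adValues I m))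

theorem measurable_criticalBid (m : Fin 3) :
    Measurable fun b => sInf (E.winningBids I b m) := by
  refine measurable_of_Iio fun c => ?_
  -- Winning bids are up-closed: the rational ones and the highest bid determine the infimum.
  let Q : Set ℝ := insert (E.B m) (Set.range ((↑) : ℚ → ℝ))
  have hQ : Q.Countable := (Set.countable_range _).insert _
  have hB : E.B m ∈ Icc 0 (E.B m) := ⟨E.B_nonneg m, le_rfl⟩
  have : (fun b => sInf (E.winningBids I b m)) ⁻¹' Iio c
      = ({b | E.B m ∉ E.winningBids I b m} ∩ {_b | 0 < c})
        ∪ ⋃ q ∈ Q, {b | q ∈ E.winningBids I b m} ∩ {_b | q < c} := by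
    ext b
    simp only [mem_preimage, mem_Iio, mem_union, mem_inter_iff, mem_ofPred_eq, mem_iUnion,
      exists_prop]
    by_cases hne : E.B m ∈ E.winningBids I b m
    · simp only [hne, not_true_eq_false, false_and, false_or]
      constructor
      · intro h
        obtain ⟨s, hs, hsc⟩ := exists_lt_of_csInf_lt ⟨_, hne⟩ h
        rcases hs.1.2.lt_or_eq with h1 | h1
        · obtain ⟨q, hsq, hq⟩ := exists_rat_btwn (lt_min hsc h1)
          rw [lt_min_iff] at hq
          exact ⟨q, Or.inr ⟨q, rfl⟩, E.winningBids_upper I s hs q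
            ⟨hs.1.1.trans hsq.le, hq.2.le⟩ hsq.le, hq.1⟩
        · exact ⟨E.B m, Or.inl rfl, hne, h1 ▸ hsc⟩
      · rintro ⟨q, _, hq, hqc⟩
        exact (csInf_le ⟨0, fun s hs => hs.1.1⟩ hq).trans_lt hqc
    · have hem : E.winningBids I b m = ∅ := by
        refine eq_empty_of_forall_notMem fun t ht => hne ?_
        exact E.winningBids_upper I t ht _ hB ht.1.2
      simp [hem]
  rw [this]
  exact ((E.measurableSet_mem_winningBids I m _).compl.inter (MeasurableSet.const _)).union
    (MeasurableSet.biUnion hQ fun q _ =>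
      (E.measurableSet_mem_winningBids I m q).inter (MeasurableSet.const _))

theorem changeMechanism_x (b : Fin 3 → ℝ) (m : Fin 3) : (E.changeMechanism I).x b m
    = if m ∈ E.adItems I (E.adValues b) then 1 else 0 := rfl

theorem changeMechanism_y (b : Fin 3 → ℝ) (m : Fin 3) : (E.changeMechanism I).y b m
    = if m ∈ E.organicItems I (E.adValues b) then 1 else 0 := rfl

theorem changeMechanism_p (b : Fin 3 → ℝ) (m : Fin 3) : (E.changeMechanism I).p b m
    = if m ∈ E.adItems I (E.adValues b) then sInf (E.winningBids I b m) else 0 := rfl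

theorem measurable_changeMechanism_x (m : Fin 3) :
    Measurable fun b => (E.changeMechanism I).x b m :=
  Measurable.ite (E.measurableSet_mem_adItems_adValues I m) measurable_const measurable_const

theorem measurable_changeMechanism_y (m : Fin 3) :
    Measurable fun b => (E.changeMechanism I).y b m :=
  Measurable.ite
    (E.measurable_adValues (measurableSet_mem_organicItems (E.measurable_sStar I) m))
    measurable_const measurable_const

theorem measurable_changeMechanism_p (m : Fin 3) :
    Measurable fun b => (E.changeMechanism I).p b m :=
  Measurable.ite (E.measurableSet_mem_adItems_adValues I m) (E.measurable_criticalBid I m)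
    measurable_const

theorem integrable_changeMechanism_revenue (m : Fin 3) : Integrable
    (fun b => (E.changeMechanism I).p b m * (E.changeMechanism I).x b m * E.αA m)
    E.jointLaw := by
  refine Integrable.of_bound (C := E.B m * E.αA m)
    (((E.measurable_changeMechanism_p I m).mul (E.measurable_changeMechanism_x I m)).mul_const
      _).aestronglyMeasurable (Filter.Eventually.of_forall fun b => ?_)
  have h := E.sInf_winningBids_mem I b m
  have hα := E.αA_nonneg m
  rw [changeMechanism_x, changeMechanism_p]
  split_ifs
  · rw [mul_one, Real.norm_of_nonneg (mul_nonneg h.1 hα)]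
    exact mul_le_mul_of_nonneg_right h.2 hα
  · simpa using mul_nonneg (E.B_nonneg m) hα

theorem organicItems_update (b : Fin 3 → ℝ) (m : Fin 3) (t : ℝ) :
    m ∈ E.organicItems I (E.adValues (Function.update b m t))
      ↔ m ∈ E.organicItems I (E.adValues b) := by
  rw [adValues_update, mem_organicItems_update]

/-- An owner faces either the organic form at every own bid, or a posted price for the ad. -/
theorem changeMechanism_IC : E.IC (E.changeMechanism I) := by
  intro b hb m t ht
  have hα := E.αA_nonneg m
  simp only [ctr, pay, changeMechanism_x, changeMechanism_y, changeMechanism_p,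
    organicItems_update, winningBids_update]
  by_cases ho : m ∈ E.organicItems I (E.adValues b)
  · have h1 : m ∉ E.adItems I (E.adValues b) := fun h => E.disjoint_adItems I h ho
    have h2 : m ∉ E.adItems I (E.adValues (Function.update b m t)) := fun h =>
      E.disjoint_adItems I h ((E.organicItems_update I b m t).2 ho)
    simp [h1, h2]
  · have hbdd : BddBelow (E.winningBids I b m) := ⟨0, fun s hs => hs.1.1⟩
    have hself : m ∈ E.adItems I (E.adValues b) ↔ b m ∈ E.winningBids I b m := by
      simp [winningBids, show 0 ≤ b m from (hb m).1, show b m ≤ E.B m from (hb m).2]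
    have hdev : m ∈ E.adItems I (E.adValues (Function.update b m t))
        ↔ t ∈ E.winningBids I b m := by
      simp [winningBids, ht.1, ht.2]
    simp only [hself, hdev]
    by_cases h1 : b m ∈ E.winningBids I b m
    · have := mul_le_mul_of_nonneg_right (csInf_le hbdd h1) hα
      by_cases h2 : t ∈ E.winningBids I b m
      · simp [h1, h2, ho]
      · simp only [h1, h2, ho, if_true, if_false]
        linarith
    · by_cases h2 : t ∈ E.winningBids I b m
      · have hle : b m ≤ sInf (E.winningBids I b m) := by
          refine le_csInf ⟨t, h2⟩ fun s hs => ?_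
          by_contra! hlt
          exact h1 (E.winningBids_upper I s hs _ (hb m) hlt.le)
        have := mul_le_mul_of_nonneg_right hle hα
        simp only [h1, h2, ho, if_true, if_false]
        linarith
      · simp [h1, h2, ho]

theorem changeMechanism_IR : E.IR (E.changeMechanism I) := by
  intro b hb m
  rw [changeMechanism_p]
  split_ifs with h
  · refine csInf_le ⟨0, fun s hs => hs.1.1⟩ ⟨hb m, ?_⟩
    rwa [Function.update_eq_self]
  · exact (hb m).1

theorem changeMechanism_feasible : E.Feasible 2 (E.changeMechanism I) := by
  intro b _
  refine ⟨?_, fun m => ?_⟩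
  · have h1 : ∑ m, (E.changeMechanism I).x b m = ((E.adItems I (E.adValues b)).card : ℝ) := by
      simp [changeMechanism_x]
    have h2 : ∑ m, (E.changeMechanism I).y b m
        = ((E.organicItems I (E.adValues b)).card : ℝ) := by
      simp [changeMechanism_y]
    rw [Finset.sum_add_distrib, h1, h2, adItems_eq_leaders,
      card_leaders (E.card_compl_organicItems I _), organicItems,
      card_firstItems I (E.sStar_le I _)]
    have := E.sStar_le I (E.adValues b)
    norm_cast
    omega
  · rw [changeMechanism_x, changeMechanism_y]
    split_ifs with h h'
    · exact absurd h' (E.disjoint_adItems I h)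
    all_goals norm_num

theorem changeMechanism_admissible : E.Admissible 2 (E.changeMechanism I) :=
  ⟨⟨E.measurable_changeMechanism_x I, E.measurable_changeMechanism_y I,
    E.measurable_changeMechanism_p I,
    integrable_finsetSum _ fun m _ => E.integrable_changeMechanism_revenue I m⟩,
    E.changeMechanism_IC I, E.changeMechanism_IR I, E.changeMechanism_feasible I⟩

/-- The contribution of the items displayed by the change mechanism when each ad counts with its
virtual contribution `a_i`. -/
noncomputable def virtualContribution (a : Fin 3 → ℝ) : ℝ :=
  ∑ m ∈ E.organicItems I a, E.γO m + ∑ m ∈ E.adItems I a, a m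

theorem virtualContribution_eq {l : Fin 3} (h0 : l ≠ I 0) (h1 : l ≠ I 1) (a : Fin 3 → ℝ) :
    E.virtualContribution I a =
      if E.organicMean (I 0) (I 1) (a l) ≤ E.γO (I 0) + E.γO (I 1) then
        E.γO (I 0) + E.γO (I 1)
      else max (a (I 1)) (a l) +
        if E.meanMax (I 0) (min (a (I 1)) (a l)) ≤ E.γO (I 0) then E.γO (I 0)
        else max (a (I 0)) (min (a (I 1)) (a l)) := by
  have hi : I 0 ≠ I 1 := I.injective.ne (by decide)
  rw [virtualContribution, adItems_eq_leaders, sum_leaders (E.card_compl_organicItems I _),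
    organicItems]
  have hs1 := E.one_lt_sStar_iff h0 h1 a
  have hs0 := E.sStar_pos_iff h0 h1 a
  have hle : E.sStar I a ≤ 2 := E.sStar_le I a
  split_ifs with hW hg
  · have : E.sStar I a = 2 := by have := hs1.2 hW; omega
    simp [this, firstItems_two, topSum_zero, Finset.sum_pair hi]
  · have : E.sStar I a = 1 := by
      have h1 := hs0.2 (Or.inl hg)
      have h2 := mt hs1.1 hW
      omega
    rw [this, compl_firstItems_one h0 h1, firstItems_one]
    change _ + topSum 1 _ _ = _
    rw [topSum_one_pair h1.symm, Finset.sum_singleton, add_comm]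
  · have : E.sStar I a = 0 := by
      have h1 := mt hs0.1 (not_or.2 ⟨hg, hW⟩)
      omega
    rw [this, firstItems_zero, Finset.compl_empty, Finset.sum_empty, zero_add]
    exact topSum_two_items h0 h1 a

/-- Myerson's lemma for the change mechanism. -/
theorem integral_changeMechanism_item (b : Fin 3 → ℝ) (m : Fin 3) :
    ∫ s, ((E.changeMechanism I).p (Function.update b m s) m
        * (E.changeMechanism I).x (Function.update b m s) m * E.αA m
      + ((E.changeMechanism I).x (Function.update b m s) m * E.γA m
        + (E.changeMechanism I).y (Function.update b m s) m * E.γO m)) ∂E.law m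
    = ∫ s, ((E.changeMechanism I).x (Function.update b m s) m * E.adValue m s
        + (E.changeMechanism I).y (Function.update b m s) m * E.γO m) ∂E.law m := by
  simp only [changeMechanism_x, changeMechanism_y, changeMechanism_p, organicItems_update,
    winningBids_update]
  by_cases ho : m ∈ E.organicItems I (E.adValues b)
  · have h2 : ∀ t, m ∉ E.adItems I (E.adValues (Function.update b m t)) := fun t h =>
      E.disjoint_adItems I h ((E.organicItems_update I b m t).2 ho)
    simp [h2]
  · set S := E.winningBids I b m with hS
    have hSm : MeasurableSet S := by
      have hu : Measurable fun t : ℝ => Function.update b m t := measurable_update b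
      exact measurableSet_Icc.inter (hu (E.measurableSet_mem_adItems_adValues I m))
    have hae : ∀ᵐ t ∂E.law m,
        (m ∈ E.adItems I (E.adValues (Function.update b m t)) ↔ t ∈ S) := by
      filter_upwards [E.law_ae_mem_Icc m] with t ht
      exact ⟨fun h => ⟨ht, h⟩, fun h => h.2⟩
    have hmy := E.setIntegral_virtualValue m (S := S) (fun t ht => ht.1)
      (E.winningBids_upper I)
    have hL : ∫ s, S.indicator (fun _ => sInf S * E.αA m + E.γA m) s ∂E.law m
        = ∫ s, S.indicator (E.adValue m) s ∂E.law m := by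
      rw [integral_indicator hSm, integral_indicator hSm]
      unfold adValue
      rw [integral_add ((E.integrable_virtualValue m).mul_const _).integrableOn
        (integrable_const _).integrableOn, integral_mul_const, hmy]
      simp
      ring
    calc _ = _ := integral_congr_ae ?_
      _ = _ := hL
      _ = _ := integral_congr_ae ?_
    · filter_upwards [hae] with t ht
      by_cases h : t ∈ S <;> simp [ht, h, ho]
    · filter_upwards [hae] with t ht
      by_cases h : t ∈ S <;> simp [ht, h, ho]

theorem integrable_adValue_eval (m : Fin 3) :
    Integrable (fun b : Fin 3 → ℝ => E.adValue m (b m)) E.jointLaw :=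
  (measurePreserving_eval E.law m).integrable_comp_of_integrable (E.integrable_adValue m)

theorem integrable_changeMechanism_experience (m : Fin 3) : Integrable
    (fun b => (E.changeMechanism I).x b m * E.γA m + (E.changeMechanism I).y b m * E.γO m)
    E.jointLaw := by
  refine Integrable.of_bound (C := |E.γA m| + |E.γO m|)
    (((E.measurable_changeMechanism_x I m).mul_const _).add
      ((E.measurable_changeMechanism_y I m).mul_const _)).aestronglyMeasurable
    (Filter.Eventually.of_forall fun b => (norm_add_le _ _).trans ?_)
  rw [changeMechanism_x, changeMechanism_y]
  refine add_le_add ?_ ?_ <;> split_ifs <;> simp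

theorem integrable_changeMechanism_virtual (m : Fin 3) : Integrable
    (fun b => (E.changeMechanism I).x b m * E.adValue m (b m)
      + (E.changeMechanism I).y b m * E.γO m) E.jointLaw := by
  have h1 : Integrable (fun b => (E.changeMechanism I).x b m * E.adValue m (b m))
      E.jointLaw := by
    refine (E.integrable_adValue_eval m).bdd_mul (c := 1)
      (E.measurable_changeMechanism_x I m).aestronglyMeasurable
      (Filter.Eventually.of_forall fun b => ?_)
    rw [changeMechanism_x]
    split_ifs <;> simp
  refine h1.add (Integrable.mul_const (Integrable.of_bound (C := 1)
    (E.measurable_changeMechanism_y I m).aestronglyMeasurable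
      (Filter.Eventually.of_forall fun b => ?_)) _)
  rw [changeMechanism_y]
  split_ifs <;> simp

theorem virtualContribution_adValues (b : Fin 3 → ℝ) :
    E.virtualContribution I (E.adValues b) = ∑ m, ((E.changeMechanism I).x b m * E.adValue m (b m)
      + (E.changeMechanism I).y b m * E.γO m) := by
  simp only [virtualContribution, changeMechanism_x, changeMechanism_y, ite_mul, one_mul,
    zero_mul, Finset.sum_add_distrib, Finset.sum_ite_mem, Finset.univ_inter, adValues]
  rw [add_comm]

theorem integrable_virtualContribution :
    Integrable (fun b => E.virtualContribution I (E.adValues b)) E.jointLaw := by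
  simp only [virtualContribution_adValues]
  exact integrable_finsetSum _ fun m _ => E.integrable_changeMechanism_virtual I m

theorem obj_changeMechanism :
    E.obj (E.changeMechanism I) = ∫ b, E.virtualContribution I (E.adValues b) ∂E.jointLaw := by
  simp only [virtualContribution_adValues]
  rw [obj, rev, ue, ← integral_add
    (integrable_finsetSum _ fun m _ => E.integrable_changeMechanism_revenue I m)
    (integrable_finsetSum _ fun m _ => E.integrable_changeMechanism_experience I m),
    integral_finsetSum _ fun m _ => E.integrable_changeMechanism_virtual I m]
  simp only [← Finset.sum_add_distrib]
  refine (integral_finsetSum _ fun m _ => (E.integrable_changeMechanism_revenue I m).add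
    (E.integrable_changeMechanism_experience I m)).trans ?_
  refine Finset.sum_congr rfl fun m _ => ?_
  have h1 := integral_pi_eq_integral_update m ((E.integrable_changeMechanism_revenue I m).add
    (E.integrable_changeMechanism_experience I m))
  have h2 := integral_pi_eq_integral_update m (E.integrable_changeMechanism_virtual I m)
  refine h1.trans (Eq.trans ?_ h2.symm)
  congr 1
  ext b
  simpa using E.integral_changeMechanism_item I b m

end Model

/-! ### The upper bound for all mechanisms, and its attainment -/

namespace Model

section Upper

variable {n : ℕ} (E : Model n)

/-- The index of an item: a value `c` at which `max a_i c` has mean `γO_i`. If there is none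
because already the mean of `a_i` exceeds `γO_i`, a negative value stands for `-∞`. -/
theorem exists_index (i : Fin n) (ha : ∀ t ∈ Icc 0 (E.B i), 0 ≤ E.adValue i t) :
    ∃ c, E.γO i ≤ E.meanMax i c ∧ (0 ≤ c → E.meanMax i c = E.γO i) := by
  have hmean : ∀ u ≤ 0, E.meanMax i u = ∫ t, E.adValue i t ∂E.law i := fun u hu => by
    refine integral_congr_ae ?_
    filter_upwards [E.law_ae_mem_Icc i] with t ht
    exact max_eq_left (hu.trans (ha t ht))
  by_cases h : ∫ t, E.adValue i t ∂E.law i ≤ E.γO i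
  · have hO : 0 ≤ E.γO i := (E.γA_nonneg i).trans (E.γA_le_γO i)
    have h1 : E.γO i ≤ E.meanMax i (E.γO i) := by
      have : ∫ _t, E.γO i ∂E.law i = E.γO i := by simp
      rw [← this]
      exact integral_mono (integrable_const _) (by simpa using E.integrable_max_adValue i (E.γO i))
        fun t => by simp
    obtain ⟨c, -, hc⟩ := intermediate_value_Icc hO (E.continuous_meanMax i).continuousOn
      ⟨(hmean 0 le_rfl).trans_le h, h1⟩
    exact ⟨c, hc.ge, fun _ => hc⟩
  · refine ⟨-1, ?_, fun h => absurd h (by norm_num)⟩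
    rw [hmean (-1) (by norm_num)]
    exact (not_le.1 h).le

/-- The contribution of one item to the objective, as its owner's bid varies: an item that is
displayed, in whichever form, counts at most `max a_i c`. -/
theorem item_contribution_le (i : Fin n) {x y p : ℝ → ℝ} (hxm : Measurable x) (hym : Measurable y)
    (hx : ∀ t, x t = 0 ∨ x t = 1) (hy : ∀ t, y t = 0 ∨ y t = 1)
    (hint : Integrable (fun t => p t * x t * E.αA i) (E.law i))
    (hIC : ∀ s ∈ Icc 0 (E.B i), ∀ t ∈ Icc 0 (E.B i),
      s * (x t * E.αA i + y t * E.αO i) - p t * (x t * E.αA i)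
        ≤ s * (x s * E.αA i + y s * E.αO i) - p s * (x s * E.αA i))
    (hIR : ∀ t ∈ Icc 0 (E.B i), p t ≤ t) (hF : ∀ t ∈ Icc 0 (E.B i), x t + y t ≤ 1)
    {c : ℝ} (hc : E.γO i ≤ E.meanMax i c) :
    ∫ t, (p t * x t * E.αA i + (x t * E.γA i + y t * E.γO i)) ∂E.law i
      ≤ ∫ t, (x t + y t) * max (E.adValue i t) c ∂E.law i := by
  have hαA := E.αA_nonneg i
  have hαO := E.αA_lt_αO i
  have hγ := E.γA_le_γO i
  have hB : E.B i ∈ Icc 0 (E.B i) := ⟨E.B_nonneg i, le_rfl⟩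
  have hbound : ∀ {z : ℝ → ℝ}, (∀ t, z t = 0 ∨ z t = 1) → ∀ t, ‖z t‖ ≤ 1 := fun hz t => by
    rcases hz t with h | h <;> simp [h]
  have hxi : ∀ {g : ℝ → ℝ}, Integrable g (E.law i) →
      Integrable (fun t => x t * g t) (E.law i) := fun hg =>
    hg.bdd_mul hxm.aestronglyMeasurable (Filter.Eventually.of_forall (hbound hx))
  have hyi : ∀ {g : ℝ → ℝ}, Integrable g (E.law i) →
      Integrable (fun t => y t * g t) (E.law i) := fun hg =>
    hg.bdd_mul hym.aestronglyMeasurable (Filter.Eventually.of_forall (hbound hy))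
  have hLint : Integrable (fun t => p t * x t * E.αA i + (x t * E.γA i + y t * E.γO i))
      (E.law i) :=
    hint.add ((hxi (integrable_const _)).add (hyi (integrable_const _)))
  rcases hy (E.B i) with hyB | hyB
  · -- The organic form is never displayed, and the ad is sold at a posted price.
    have hy0 : ∀ t ∈ Icc 0 (E.B i), y t = 0 := fun t ht => by
      rcases ht.2.lt_or_eq with h | rfl
      · rcases hy t with h0 | h1
        · exact h0
        · exfalso
          have hx0 : x t = 0 := by
            rcases hx t with h | h
            · exact h
            · have := hF t ht; rw [h, h1] at this; norm_num at this
          have e1 := hIC _ hB t ht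
          have e2 := hIC t ht _ hB
          rw [h1, hx0, hyB] at e1 e2
          rcases hx (E.B i) with h | h <;> rw [h] at e1 e2 <;> nlinarith
      · exact hyB
    have hkey : ∫ t, p t * x t * E.αA i ∂E.law i
        ≤ ∫ t, x t * (virtualValue (E.f i) t * E.αA i) ∂E.law i := by
      rcases hαA.lt_or_eq with hpos | h0
      · set S : Set ℝ := {t | t ∈ Icc 0 (E.B i) ∧ x t = 1} with hS
        have hSm : MeasurableSet S := measurableSet_Icc.inter (hxm (measurableSet_singleton 1))
        have hup : ∀ s ∈ S, ∀ t ∈ Icc 0 (E.B i), s ≤ t → t ∈ S := by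
          rintro s ⟨hs, hs1⟩ t ht hst
          refine ⟨ht, (hx t).resolve_left fun h0 => ?_⟩
          have e1 := hIC s hs t ht
          have e2 := hIC t ht s hs
          rw [h0, hs1, hy0 s hs, hy0 t ht] at e1 e2
          have hne : s < t := lt_of_le_of_ne hst (by rintro rfl; rw [h0] at hs1; norm_num at hs1)
          nlinarith
        have hprice : ∀ t ∈ S, p t ≤ sInf S := by
          rintro t ⟨ht, ht1⟩
          refine le_csInf ⟨t, ht, ht1⟩ ?_
          rintro s ⟨hs, hs1⟩
          have e := hIC t ht s hs
          rw [hs1, ht1, hy0 s hs, hy0 t ht] at e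
          have : p t ≤ p s := le_of_mul_le_mul_right (by linarith) hpos
          exact this.trans (hIR s hs)
        have hnot : ∀ {t}, x t = 0 → t ∉ S := fun h h' => by
          have := h'.2
          rw [h] at this
          norm_num at this
        have hmy := E.setIntegral_virtualValue i (S := S) (fun t ht => ht.1) hup
        calc ∫ t, p t * x t * E.αA i ∂E.law i
            ≤ ∫ t, S.indicator (fun _ => sInf S * E.αA i) t ∂E.law i := by
              refine integral_mono_ae hint ((integrable_const _).indicator hSm) ?_
              filter_upwards [E.law_ae_mem_Icc i] with t ht
              rcases hx t with h | h
              · simp [h, hnot h]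
              · have hm : t ∈ S := ⟨ht, h⟩
                simp only [h, hm, indicator_of_mem, mul_one]
                exact mul_le_mul_of_nonneg_right (hprice t hm) hαA
          _ = ∫ t, S.indicator (fun t => virtualValue (E.f i) t * E.αA i) t ∂E.law i := by
              rw [integral_indicator hSm, integral_indicator hSm, integral_mul_const (E.αA i)
                (virtualValue (E.f i)), hmy]
              simp
              ring
          _ = _ := by
              refine integral_congr_ae ?_
              filter_upwards [E.law_ae_mem_Icc i] with t ht
              rcases hx t with h | h
              · simp [h, hnot h]
              · have hm : t ∈ S := ⟨ht, h⟩
                simp [h, hm]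
      · simp [← h0]
    have hsplit : ∫ t, (p t * x t * E.αA i + (x t * E.γA i + y t * E.γO i)) ∂E.law i
        = ∫ t, p t * x t * E.αA i ∂E.law i + ∫ t, x t * E.γA i ∂E.law i := by
      rw [← integral_add hint (hxi (integrable_const _))]
      refine integral_congr_ae ?_
      filter_upwards [E.law_ae_mem_Icc i] with t ht
      simp [hy0 t ht]
    calc _ = _ := hsplit
      _ ≤ ∫ t, x t * (virtualValue (E.f i) t * E.αA i) ∂E.law i + ∫ t, x t * E.γA i ∂E.law i :=
        add_le_add hkey le_rfl
      _ = ∫ t, x t * E.adValue i t ∂E.law i := by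
        rw [← integral_add (hxi ((E.integrable_virtualValue i).mul_const _))
          (hxi (integrable_const _))]
        simp only [adValue, mul_add]
      _ ≤ _ := by
        refine integral_mono_ae (hxi (E.integrable_adValue i)) ?_ ?_
        · simp only [add_mul]
          exact (hxi (E.integrable_max_adValue i c)).add (hyi (E.integrable_max_adValue i c))
        · filter_upwards [E.law_ae_mem_Icc i] with t ht
          rw [hy0 t ht, add_zero]
          refine mul_le_mul_of_nonneg_left (le_max_left _ _) ?_
          rcases hx t with h | h <;> simp [h]
  · -- Being displayed organically at the highest bid, the item is displayed at every positive
    -- bid, and where it is displayed as an ad its owner is paid for the lost clicks.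
    have hxB : x (E.B i) = 0 := by
      rcases hx (E.B i) with h | h
      · exact h
      · have := hF _ hB; rw [h, hyB] at this; norm_num at this
    have hcase : ∀ t ∈ Ioo 0 (E.B i), x t + y t = 1 ∧ p t * x t * E.αA i ≤ 0 := fun t ht => by
      have ht' : t ∈ Icc 0 (E.B i) := ⟨ht.1.le, ht.2.le⟩
      have e := hIC t ht' _ hB
      have hf := hF t ht'
      have hpos : 0 < t * (E.αO i - E.αA i) := mul_pos ht.1 (by linarith)
      have hpos' : 0 ≤ t * E.αA i := mul_nonneg ht.1.le hαA
      rw [hxB, hyB] at e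
      rcases hx t with h | h <;> rcases hy t with h' | h' <;> rw [h, h'] at e hf ⊢
      · exfalso; nlinarith
      · norm_num
      · refine ⟨by norm_num, by nlinarith⟩
      · norm_num at hf
    calc _ ≤ ∫ _t, E.γO i ∂E.law i := by
          refine integral_mono_ae hLint (integrable_const _) ?_
          filter_upwards [E.law_ae_mem_Ioo i] with t ht
          obtain ⟨h1, h2⟩ := hcase t ht
          have hx0 : 0 ≤ x t := by rcases hx t with h | h <;> simp [h]
          have : x t * E.γA i ≤ x t * E.γO i := mul_le_mul_of_nonneg_left hγ hx0
          have h3 : x t * E.γO i + y t * E.γO i = E.γO i := by rw [← add_mul, h1, one_mul]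
          linarith
      _ = E.γO i := by simp
      _ ≤ E.meanMax i c := hc
      _ = _ := by
          refine integral_congr_ae ?_
          filter_upwards [E.law_ae_mem_Ioo i] with t ht
          rw [(hcase t ht).1, one_mul]

theorem integrable_max_adValue_eval (c : ℝ) (m : Fin n) :
    Integrable (fun b : Fin n → ℝ => max (E.adValue m (b m)) c) E.jointLaw :=
  (measurePreserving_eval E.law m).integrable_comp_of_integrable (E.integrable_max_adValue m c)

variable {E}

/-- The owners pay at most their bids, so that no payment can be unboundedly positive and offset
another unboundedly negative one. -/
theorem integrable_payment {k : ℕ} {M : Mechanism n} (hM : E.Admissible k M) (m : Fin n) :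
    Integrable (fun b => M.p b m * M.x b m * E.αA m) E.jointLaw := by
  obtain ⟨⟨hxm, hym, hpm, hint⟩, -, hIR, -⟩ := hM
  refine Integrable.mono' (hint.abs.add (integrable_const (∑ j, E.B j * E.αA j)))
    (((hpm m).mul (hxm m)).mul_const _).aestronglyMeasurable ?_
  filter_upwards [E.jointLaw_ae_mem_bids] with b hb
  have hC : ∀ j, 0 ≤ E.B j * E.αA j := fun j => mul_nonneg (E.B_nonneg j) (E.αA_nonneg j)
  have hle : ∀ j, M.p b j * M.x b j * E.αA j ≤ E.B j * E.αA j := fun j => by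
    rcases M.x_zero_or_one b j with h | h
    · simpa [h] using hC j
    · rw [h, mul_one]
      exact mul_le_mul_of_nonneg_right ((hIR b hb j).trans (hb j).2) (E.αA_nonneg j)
  have h1 : E.B m * E.αA m ≤ ∑ j, E.B j * E.αA j :=
    Finset.single_le_sum (f := fun j => E.B j * E.αA j) (fun j _ => hC j) (Finset.mem_univ m)
  have h2 : ∑ j ∈ Finset.univ.erase m, M.p b j * M.x b j * E.αA j
      ≤ ∑ j ∈ Finset.univ.erase m, E.B j * E.αA j := Finset.sum_le_sum fun j _ => hle j
  have h3 := Finset.add_sum_erase Finset.univ (fun j => M.p b j * M.x b j * E.αA j)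
    (Finset.mem_univ m)
  have h4 := Finset.add_sum_erase Finset.univ (fun j => E.B j * E.αA j) (Finset.mem_univ m)
  have h5 := hle m
  have h6 := hC m
  have h7 := neg_abs_le (∑ j, M.p b j * M.x b j * E.αA j)
  have h8 := abs_nonneg (∑ j, M.p b j * M.x b j * E.αA j)
  simp only [Pi.add_apply, Real.norm_eq_abs]
  exact abs_le.2 ⟨by linarith, by linarith⟩

theorem sum_displayed_le_topSum {k : ℕ} (hk : k ≤ n) {z h : Fin n → ℝ}
    (hz : ∀ i, z i = 0 ∨ z i = 1) (hsum : ∑ i, z i ≤ k) (hh : ∀ i, 0 ≤ h i) :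
    ∑ i, z i * h i ≤ topSum k Finset.univ h := by
  set D := Finset.univ.filter fun i => z i = 1 with hD
  have hz' : ∀ i, z i = if i ∈ D then 1 else 0 := fun i => by
    rcases hz i with h | h <;> simp [hD, h]
  have hcard : D.card ≤ k := by
    have : ∑ i, z i = (D.card : ℝ) := by
      rw [Finset.sum_congr rfl fun i _ => hz' i]; simp
    rw [this] at hsum
    exact_mod_cast hsum
  obtain ⟨T, hDT, hT⟩ := Finset.exists_superset_card_eq hcard (by simpa using hk)
  calc ∑ i, z i * h i = ∑ i ∈ D, h i := by
        rw [Finset.sum_congr rfl fun i _ => by rw [hz' i]]; simp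
    _ ≤ ∑ i ∈ T, h i := Finset.sum_le_sum_of_subset_of_nonneg hDT fun i _ _ => hh i
    _ ≤ _ := sum_le_topSum (Finset.subset_univ T) hT

/-- No mechanism does better than showing the `k` items with the largest `max a_i c_i`. -/
theorem obj_le {k : ℕ} (hk : k ≤ n) {M : Mechanism n} (hM : E.Admissible k M)
    (ha : ∀ i, ∀ t ∈ Icc 0 (E.B i), 0 ≤ E.adValue i t)
    {c : Fin n → ℝ} (hc : ∀ i, E.γO i ≤ E.meanMax i (c i))
    (hH : Integrable (fun b => topSum k Finset.univ fun i => max (E.adValue i (b i)) (c i))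
      E.jointLaw) :
    E.obj M ≤ ∫ b, topSum k Finset.univ (fun i => max (E.adValue i (b i)) (c i)) ∂E.jointLaw := by
  have hpay := integrable_payment hM
  obtain ⟨⟨hxm, hym, hpm, hint⟩, hIC, hIR, hF⟩ := hM
  have hxi : ∀ m, ∀ {g : (Fin n → ℝ) → ℝ}, Integrable g E.jointLaw →
      Integrable (fun b => M.x b m * g b) E.jointLaw := fun m _ hg =>
    hg.bdd_mul (c := 1) (hxm m).aestronglyMeasurable (Filter.Eventually.of_forall fun b => by
      rcases M.x_zero_or_one b m with h | h <;> simp [h])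
  have hyi : ∀ m, ∀ {g : (Fin n → ℝ) → ℝ}, Integrable g E.jointLaw →
      Integrable (fun b => M.y b m * g b) E.jointLaw := fun m _ hg =>
    hg.bdd_mul (c := 1) (hym m).aestronglyMeasurable (Filter.Eventually.of_forall fun b => by
      rcases M.y_zero_or_one b m with h | h <;> simp [h])
  have hue : ∀ m, Integrable (fun b => M.x b m * E.γA m + M.y b m * E.γO m) E.jointLaw :=
    fun m => (hxi m (integrable_const _)).add (hyi m (integrable_const _))
  have hr : ∀ m, Integrable (fun b => M.p b m * M.x b m * E.αA m
      + (M.x b m * E.γA m + M.y b m * E.γO m)) E.jointLaw := fun m => (hpay m).add (hue m)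
  have hd : ∀ m, Integrable
      (fun b => (M.x b m + M.y b m) * max (E.adValue m (b m)) (c m)) E.jointLaw := fun m => by
    simp only [add_mul]
    exact (hxi m (E.integrable_max_adValue_eval _ m)).add
      (hyi m (E.integrable_max_adValue_eval _ m))
  have hobj : E.obj M = ∑ m, ∫ b, (M.p b m * M.x b m * E.αA m
      + (M.x b m * E.γA m + M.y b m * E.γO m)) ∂E.jointLaw := by
    rw [obj, rev, ue, ← integral_add hint (integrable_finsetSum _ fun m _ => hue m),
      ← integral_finsetSum _ fun m _ => hr m]
    simp only [← Finset.sum_add_distrib]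
  have hitem : ∀ m, ∫ b, (M.p b m * M.x b m * E.αA m
      + (M.x b m * E.γA m + M.y b m * E.γO m)) ∂E.jointLaw
      ≤ ∫ b, (M.x b m + M.y b m) * max (E.adValue m (b m)) (c m) ∂E.jointLaw := fun m => by
    have h1 := integral_pi_eq_integral_update m (hr m)
    have h2 := integral_pi_eq_integral_update m (hd m)
    refine h1.trans_le (le_trans ?_ h2.symm.le)
    refine integral_mono_ae (integrable_integral_update m (hr m))
      (integrable_integral_update m (hd m)) ?_
    filter_upwards [E.jointLaw_ae_mem_bids, ae_integrable_update m (hpay m)] with b hb hi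
    have hu : Measurable fun t : ℝ => Function.update b m t := measurable_update b
    have hbt : ∀ t ∈ Icc 0 (E.B m), Function.update b m t ∈ E.bids := fun t ht j => by
      by_cases hj : j = m
      · subst hj; simpa using ht
      · simpa [Function.update_of_ne hj] using hb j
    have := E.item_contribution_le m (x := fun t => M.x (Function.update b m t) m)
      (y := fun t => M.y (Function.update b m t) m) (p := fun t => M.p (Function.update b m t) m)
      ((hxm m).comp hu) ((hym m).comp hu) (fun t => M.x_zero_or_one _ _)
      (fun t => M.y_zero_or_one _ _) hi
      (fun s hs t ht => by simpa [ctr, pay] using hIC _ (hbt s hs) m t ht)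
      (fun t ht => by simpa using hIR _ (hbt t ht) m)
      (fun t ht => (hF _ (hbt t ht)).2 m) (hc m)
    simpa using this
  calc E.obj M = _ := hobj
    _ ≤ ∑ m, ∫ b, (M.x b m + M.y b m) * max (E.adValue m (b m)) (c m) ∂E.jointLaw :=
      Finset.sum_le_sum fun m _ => hitem m
    _ = ∫ b, ∑ m, (M.x b m + M.y b m) * max (E.adValue m (b m)) (c m) ∂E.jointLaw :=
      (integral_finsetSum _ fun m _ => hd m).symm
    _ ≤ _ := by
      refine integral_mono_ae (integrable_finsetSum _ fun m _ => hd m) hH ?_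
      filter_upwards [E.jointLaw_ae_mem_bids] with b hb
      refine sum_displayed_le_topSum hk (fun m => ?_) (hF b hb).1
        fun m => (ha m _ (hb m)).trans (le_max_left _ _)
      have := (hF b hb).2 m
      rcases M.x_zero_or_one b m with h | h <;> rcases M.y_zero_or_one b m with h' | h' <;>
        rw [h, h'] at this ⊢ <;> first | (norm_num; done) | norm_num at this

end Upper

section Lower

variable {E : Model 3} {I : Fin 2 ↪ Fin 3} {l : Fin 3}

theorem integral_integral_virtualContribution (h0 : l ≠ I 0) (h1 : l ≠ I 1) (b : Fin 3 → ℝ) :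
    ∫ s, ∫ t, E.virtualContribution I
        (E.adValues (Function.update (Function.update b (I 1) s) (I 0) t)) ∂E.law (I 0)
        ∂E.law (I 1)
      = max (E.γO (I 0) + E.γO (I 1)) (E.organicMean (I 0) (I 1) (E.adValue l (b l))) := by
  have hi : I 1 ≠ I 0 := I.injective.ne (by decide)
  have hcoord : ∀ s t, E.adValues (Function.update (Function.update b (I 1) s) (I 0) t) (I 0)
        = E.adValue (I 0) t ∧
      E.adValues (Function.update (Function.update b (I 1) s) (I 0) t) (I 1)
        = E.adValue (I 1) s ∧
      E.adValues (Function.update (Function.update b (I 1) s) (I 0) t) l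
        = E.adValue l (b l) := fun s t => by
    simp [adValues, Function.update_of_ne h0, Function.update_of_ne h1]
  simp only [E.virtualContribution_eq I h0 h1, hcoord]
  set u := E.adValue l (b l)
  by_cases hW : E.organicMean (I 0) (I 1) u ≤ E.γO (I 0) + E.γO (I 1)
  · simp [hW]
  · simp only [hW, if_false]
    rw [max_eq_right (not_le.1 hW).le, organicMean]
    congr 1
    ext s
    rw [organicGain]
    split_ifs with hg
    · rw [max_eq_left hg]; simp
    · rw [max_eq_right (not_le.1 hg).le, integral_add (integrable_const _)
        (E.integrable_max_adValue _ _)]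
      simp [meanMax]

/-- The bound of `obj_le`, averaged over the bids of the two items of highest index. -/
theorem integral_integral_index_le (ha : ∀ i, ∀ t ∈ Icc 0 (E.B i), 0 ≤ E.adValue i t)
    {c : Fin 3 → ℝ} (hc : ∀ i, 0 ≤ c i → E.meanMax i (c i) = E.γO i)
    (h01 : c (I 1) ≤ c (I 0)) (h1l : c l ≤ c (I 1)) {u : ℝ} (hu : 0 ≤ u) :
    ∫ s, ∫ t, (max (max (E.adValue (I 1) s) (c (I 1))) (max u (c l))
        + max (max (E.adValue (I 0) t) (c (I 0)))
          (min (max (E.adValue (I 1) s) (c (I 1))) (max u (c l)))) ∂E.law (I 0) ∂E.law (I 1)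
      ≤ max (E.γO (I 0) + E.γO (I 1)) (E.organicMean (I 0) (I 1) u) := by
  have hinner : ∀ s, ∫ t, (max (max (E.adValue (I 1) s) (c (I 1))) (max u (c l))
        + max (max (E.adValue (I 0) t) (c (I 0)))
          (min (max (E.adValue (I 1) s) (c (I 1))) (max u (c l)))) ∂E.law (I 0)
      = max (max (E.adValue (I 1) s) (c (I 1))) (max u (c l)) + E.meanMax (I 0)
        (max (c (I 0)) (min (max (E.adValue (I 1) s) (c (I 1))) (max u (c l)))) := fun s => by
    simp only [max_assoc]
    rw [integral_add (integrable_const _) (E.integrable_max_adValue _ _)]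
    simp [meanMax]
  simp only [hinner]
  by_cases hul : u ≤ c (I 1)
  · -- Both items precede the third one whatever their bids, and are shown organically.
    refine le_max_of_le_left (le_of_eq ?_)
    have hm : ∀ s, max (max (E.adValue (I 1) s) (c (I 1))) (max u (c l))
        = max (E.adValue (I 1) s) (c (I 1)) := fun s => by
      have := le_max_right (E.adValue (I 1) s) (c (I 1))
      exact max_eq_left (max_le (hul.trans this) (h1l.trans this))
    have hm' : ∀ s, max (c (I 0)) (min (max (E.adValue (I 1) s) (c (I 1))) (max u (c l)))
        = c (I 0) := fun s => by
      exact max_eq_left ((min_le_right _ _).trans (max_le (hul.trans h01) (h1l.trans h01)))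
    simp only [hm, hm']
    rw [integral_add (E.integrable_max_adValue _ _) (integrable_const _),
      hc _ (hu.trans (hul.trans h01))]
    have := hc _ (hu.trans hul)
    rw [meanMax] at this
    rw [this]
    simp [add_comm]
  · refine le_max_of_le_right ?_
    rw [not_le] at hul
    have hu' : max u (c l) = u := max_eq_left (h1l.trans hul.le)
    rw [hu']
    refine integral_mono_ae ?_ (E.integrable_organicGain _ _ u) ?_
    · refine ((E.integrable_max_adValue _ _).sup (integrable_const _)).add
        (E.integrable_meanMax_comp _ ((integrable_const _).sup
          ((E.integrable_max_adValue _ _).inf (integrable_const _))))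
    · filter_upwards [E.law_ae_mem_Icc (I 1)] with s hs
      have hv := ha _ s hs
      set v := E.adValue (I 1) s
      rw [organicGain]
      refine add_le_add (by grind) ?_
      by_cases hmin : min v u ≤ c (I 0)
      · have h2 : max (c (I 0)) (min (max v (c (I 1))) u) = c (I 0) := by grind
        rw [h2, hc _ ((le_min hv hu).trans hmin)]
        exact le_max_left _ _
      · have h2 : max (c (I 0)) (min (max v (c (I 1))) u) = min v u := by grind
        rw [h2]
        exact le_max_right _ _

theorem integrable_topSum_index (c : Fin 3 → ℝ) :
    Integrable (fun b => topSum 2 Finset.univ fun i => max (E.adValue i (b i)) (c i))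
      E.jointLaw := by
  have h (i) := E.integrable_max_adValue_eval (c i) i
  simp only [topSum_two_univ (show (0 : Fin 3) ≠ 1 by decide) (show (0 : Fin 3) ≠ 2 by decide)
    (show (1 : Fin 3) ≠ 2 by decide)]
  exact ((h 1).sup (h 2)).add ((h 0).sup ((h 1).inf (h 2)))

/-- With the items ordered by index, the change mechanism attains the bound of `obj_le`. -/
theorem le_obj_changeMechanism (ha : ∀ i, ∀ t ∈ Icc 0 (E.B i), 0 ≤ E.adValue i t)
    {c : Fin 3 → ℝ} (hc : ∀ i, 0 ≤ c i → E.meanMax i (c i) = E.γO i)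
    (h0 : l ≠ I 0) (h1 : l ≠ I 1) (h01 : c (I 1) ≤ c (I 0)) (h1l : c l ≤ c (I 1)) :
    ∫ b, topSum 2 Finset.univ (fun i => max (E.adValue i (b i)) (c i)) ∂E.jointLaw
      ≤ E.obj (E.changeMechanism I) := by
  have hV := E.integrable_virtualContribution I
  have hH := integrable_topSum_index (E := E) c
  have hV' := integrable_integral_update (I 0) hV
  have hH' := integrable_integral_update (I 0) hH
  have e1 := (integral_pi_eq_integral_update (I 0) hV).trans
    (integral_pi_eq_integral_update (I 1) hV')
  have e2 := (integral_pi_eq_integral_update (I 0) hH).trans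
    (integral_pi_eq_integral_update (I 1) hH')
  rw [obj_changeMechanism]
  refine e2.trans_le (le_trans ?_ e1.symm.le)
  refine integral_mono_ae (integrable_integral_update (I 1) hH')
    (integrable_integral_update (I 1) hV') ?_
  filter_upwards [E.jointLaw_ae_mem_bids] with b hb
  rw [integral_integral_virtualContribution h0 h1]
  refine le_trans (le_of_eq ?_) (integral_integral_index_le ha hc h01 h1l (ha l _ (hb l)))
  simp only [topSum_two_items h0 h1]
  simp [Function.update_of_ne h0, Function.update_of_ne h1]

theorem exists_sorted (c : Fin 3 → ℝ) : ∃ (I : Fin 2 ↪ Fin 3) (l : Fin 3),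
    l ≠ I 0 ∧ l ≠ I 1 ∧ c (I 1) ≤ c (I 0) ∧ c l ≤ c (I 1) := by
  let σ := Tuple.sort fun i => -c i
  have hσ : Monotone ((fun i => -c i) ∘ σ) := Tuple.monotone_sort _
  refine ⟨(Fin.castLEEmb (by norm_num)).trans σ.toEmbedding, σ 2, ?_, ?_, ?_, ?_⟩
  · exact σ.injective.ne (by decide)
  · exact σ.injective.ne (by decide)
  · exact neg_le_neg_iff.1 (hσ (show (0 : Fin 3) ≤ 1 by decide))
  · exact neg_le_neg_iff.1 (hσ (show (1 : Fin 3) ≤ 2 by decide))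

end Lower

end Model

end Merging

theorem mainTheorem2 (E : Merging.Model 3)
    (ha : ∀ i, ∀ t ∈ Set.Icc 0 (E.B i), 0 ≤ E.adValue i t) :
    (∃ M : Merging.Mechanism 3, E.IsGeneralizedChange 2 M) ∧
      ∀ M : Merging.Mechanism 3, E.IsGeneralizedChange 2 M → E.IsOptimal 2 M := by
  choose c hc hc' using fun i => E.exists_index i (ha i)
  obtain ⟨I₀, l, h0, h1, h01, h1l⟩ := Merging.Model.exists_sorted c
  refine ⟨?_, ?_⟩
  · have : Nonempty (Fin 2 ↪ Fin 3) := ⟨I₀⟩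
    obtain ⟨I, hI⟩ := Finite.exists_max fun J : Fin 2 ↪ Fin 3 => E.obj (E.changeMechanism J)
    exact ⟨_, I, rfl, hI⟩
  · rintro M ⟨I, rfl, hI⟩
    refine ⟨E.changeMechanism_admissible I, fun M' hM' => ?_⟩
    exact (Merging.Model.obj_le (by norm_num) hM' ha hc
      (Merging.Model.integrable_topSum_index c)).trans
      ((Merging.Model.le_obj_changeMechanism ha hc' h0 h1 h01 h1l).trans (hI I₀))
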